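/- Let $1\le\mu<m\le n$ be integers and $q=\lfloor n/m\rfloor$. Write $\#$ for the number of real parameters (dimension) of a group or coset space. **Networks.** An *$m$-qubit network with overlap $\mu$* is a circuit on $n$ qubits of $N$ gates, each an arbitrary unitary on a set of $m$ qubits, arranged in $T$ consecutive time slots, such that gates in one slot act on disjoint sets of qubits; the first slot is filled with $q$ parallel gates (unless no later slot is in use); and the qubits of each later gate split into $m-\mu$ qubits on which it overlaps with one adjacent previous gate and $\mu$ qubits on which it overlaps with one adjacent previous gate, or which (an *overhead*) no previous gate has touched. Here a gate overlaps with an adjacent previous gate on a set $A$ of qubits if that gate acts on all of $A$ and no gate in between touches $A$. A property holds for a *generic* $n$-qubit unitary if it holds on an open dense subset of $SU(2^n)$ of full Haar measure. **Formulas.** Put $c=4^m-4^\mu-4^{m-\mu}+1=(4^{m-\mu}-1)(4^\mu-1)$ and $$g_m=\Big\lceil \tfrac{4^n-1-q(4^m-1)}{c}+q\Big\rceil,\quad g'_m=\Big\lceil \tfrac{4^n-4^{m-\mu}-q(4^m-1)}{c}+q\Big\rceil,\quad g''_m=\Big\lceil \tfrac{4^n+1-2\cdot 4^{m-\mu}-q(4^m-1)}{c}+q\Big\rceil,$$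 $$t_m=1+\Big\lceil \tfrac{4^n-1-q(4^m-1)}{qc}\Big\rceil,\quad t'_m=1+\Big\lceil \tfrac{4^n-4^{m-\mu}-q(4^m-1)}{qc}\Big\rceil,\quad t''_m=1+\Big\lceil \tfrac{4^n+1-2\cdot 4^{m-\mu}-q(4^m-1)}{qc}\Big\rceil,$$ and for an integer $k\ge 0$ $$g^{(k)}_m=\Big\lceil \tfrac{4^n-1-k(4^\mu-1)-q(4^m-1)}{c}+q\Big\rceil,\quad t^{(k)}_m=1+\Big\lceil \tfrac{4^n-1-k(4^\mu-1)-q(4^m-1)}{qc}\Big\rceil .$$ **Claims.** 1. $\#SU(2^m)=4^m-1$, $\#\frac{SU(2^m)}{SU(2^{m-\mu})\otimes 1}=4^{m-\mu}(4^\mu-1)$ and $\#\frac{SU(2^m)}{SU(2^{m-\mu})\otimes SU(2^\mu)}=(4^{m-\mu}-1)(4^\mu-1)$. 2. If $n=mq+k\mu$, then $g^{(k)}_m$ is the least $N\ge q+k$ for which $q\,\#SU(2^m)+k\,\#\frac{SU(2^m)}{SU(2^{m-\mu})\otimes 1}+(N-q-k)\,\#\frac{SU(2^m)}{SU(2^{m-\mu})\otimes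 SU(2^\mu)}\ge 4^n-1$, and for a generic $n$-qubit unitary every $m$-qubit network with overlap $\mu$ that implements it exactly has at least $g^{(k)}_m$ gates and at least $t^{(k)}_m$ time slots. 3. Consequently, for a generic $n$-qubit unitary every such network has at least $g_m=g^{(0)}_m$ gates and $t_m=t^{(0)}_m$ slots if $n=mq$; at least $g'_m$ gates and $t'_m$ slots if $n=mq+\mu$ and $2\mu\le m$; and at least $g''_m$ gates and $t''_m$ slots if $n=mq+2\mu$. If $m=2\mu$, then $g^{(1)}_m=g'_m$ and $g^{(2)}_m=g''_m$ as expressions. 4. $t_m=\lceil g_m/q\rceil$, $t'_m=\lceil g'_m/q\rceil$, $t''_m=\lceil g''_m/q\rceil$, $t^{(k)}_m=\lceil g^{(k)}_m/q\rceil$ for all $k$, and $g_m\ge g'_m\ge g''_m$ (as expressions in the same $n,m,\mu$). 5. $g''_m$ and $t''_m$, evaluated at the most efficient overlap $\lfloor m/2\rfloor$, are lower bounds for all these patterns: for a generic $n$-qubit unitary every $m$-qubit network with any overlap $\nu$, $0<\nu<m$, $n-mq\in\{0,\nu,2\nu\}$, that implements it exactly has at least $g''_m|_{\mu=\lfloor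 m/2\rfloor}$ gates and at least $t''_m|_{\mu=\lfloor m/2\rfloor}$ time slots. 6. For $m=2$, $\mu=1$: $g_2=\frac19(4^n-3n-1)$ for even $n$, $g'_2=\frac19(4^n-3n-1)$ for odd $n$, and a generic $n$-qubit unitary cannot be implemented exactly by fewer than $\frac19(4^n-3n-1)$ two-qubit gates, acting on arbitrary pairs of qubits. -/

import Mathlib

open Matrix MeasureTheory
open scoped Kronecker

noncomputable section

/-! ### Parameter counts of gates and of cosets -/

/-- The Lie algebra `su(ι)` of the special unitary group: traceless skew-Hermitian matrices,
as a real vector space. -/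
def su (ι : Type*) [Fintype ι] [DecidableEq ι] : Submodule ℝ (Matrix ι ι ℂ) where
  carrier := {X | Xᴴ = -X ∧ X.trace = 0}
  zero_mem' := by simp
  add_mem' := by
    rintro X Y ⟨hX, hX'⟩ ⟨hY, hY'⟩
    refine ⟨?_, ?_⟩
    · rw [conjTranspose_add, hX, hY]; abel
    · rw [trace_add, hX', hY', add_zero]
  smul_mem' := by
    rintro c X ⟨hX, hX'⟩
    refine ⟨?_, ?_⟩
    · rw [conjTranspose_smul, hX]; simp
    · rw [trace_smul, hX', smul_zero]

/-- The Lie algebra of the subgroup `SU(a) ⊗ 1` of `SU(a * b)`. -/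
def suLeft (a b : ℕ) : Submodule ℝ (Matrix (Fin a × Fin b) (Fin a × Fin b) ℂ) :=
  Submodule.span ℝ
    {Y | ∃ X ∈ su (Fin a), Y = X ⊗ₖ (1 : Matrix (Fin b) (Fin b) ℂ)}

/-- The Lie algebra of the subgroup `1 ⊗ SU(b)` of `SU(a * b)`. -/
def suRight (a b : ℕ) : Submodule ℝ (Matrix (Fin a × Fin b) (Fin a × Fin b) ℂ) :=
  Submodule.span ℝ
    {Y | ∃ X ∈ su (Fin b), Y = (1 : Matrix (Fin a) (Fin a) ℂ) ⊗ₖ X}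

/-- Number of real parameters of `SU(d)`, i.e. its dimension. -/
def dimSU (d : ℕ) : ℕ := Module.finrank ℝ (su (Fin d))

/-- Number of real parameters of the coset space `SU(ab) / (SU(a) ⊗ 1_b)`, i.e. the dimension of
its tangent space at the base point. -/
def dimCosetLeft (a b : ℕ) : ℕ :=
  Module.finrank ℝ
    (su (Fin a × Fin b) ⧸ (suLeft a b).submoduleOf (su (Fin a × Fin b)))

/-- Number of real parameters of the coset space `SU(ab) / (SU(a) ⊗ SU(b))`. -/
def dimCosetBoth (a b : ℕ) : ℕ :=
  Module.finrank ℝ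
    (su (Fin a × Fin b) ⧸ (suLeft a b ⊔ suRight a b).submoduleOf (su (Fin a × Fin b)))

/-- Parameters provided by `N` gates of `m` qubits on `n` qubits: the `⌊n/m⌋` gates of the first
time slot count by the group `SU(2^m)`, `k` further gates (one for each overhead of `μ` qubits) by
`SU(2^m) / (SU(2^(m-μ)) ⊗ 1)`, all others by `SU(2^m) / (SU(2^(m-μ)) ⊗ SU(2^μ))`.
Used for `n / m + k ≤ N` only. -/
def paramCount (n m μ k N : ℕ) : ℕ :=
  (n / m) * dimSU (2 ^ m) + k * dimCosetLeft (2 ^ (m - μ)) (2 ^ μ)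
    + (N - n / m - k) * dimCosetBoth (2 ^ (m - μ)) (2 ^ μ)

/-! ### The formulas (`⌈⌉` is the ceiling, `n / m` is `⌊n/m⌋`) -/

/-- `g_m`. -/
def gateA (n m μ : ℕ) : ℤ :=
  ⌈((4 : ℚ) ^ n - 1 - ((n / m : ℕ) : ℚ) * (4 ^ m - 1))
      / (4 ^ m - 4 ^ μ - 4 ^ (m - μ) + 1) + ((n / m : ℕ) : ℚ)⌉

/-- `t_m`. -/
def slotA (n m μ : ℕ) : ℤ :=
  1 + ⌈((4 : ℚ) ^ n - 1 - ((n / m : ℕ) : ℚ) * (4 ^ m - 1))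
      / (((n / m : ℕ) : ℚ) * (4 ^ m - 4 ^ μ - 4 ^ (m - μ) + 1))⌉

/-- `g'_m`. -/
def gateB (n m μ : ℕ) : ℤ :=
  ⌈((4 : ℚ) ^ n - 4 ^ (m - μ) - ((n / m : ℕ) : ℚ) * (4 ^ m - 1))
      / (4 ^ m - 4 ^ μ - 4 ^ (m - μ) + 1) + ((n / m : ℕ) : ℚ)⌉

/-- `t'_m`. -/
def slotB (n m μ : ℕ) : ℤ :=
  1 + ⌈((4 : ℚ) ^ n - 4 ^ (m - μ) - ((n / m : ℕ) : ℚ) * (4 ^ m - 1))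
      / (((n / m : ℕ) : ℚ) * (4 ^ m - 4 ^ μ - 4 ^ (m - μ) + 1))⌉

/-- `g''_m`. -/
def gateC (n m μ : ℕ) : ℤ :=
  ⌈((4 : ℚ) ^ n + 1 - 2 * 4 ^ (m - μ) - ((n / m : ℕ) : ℚ) * (4 ^ m - 1))
      / (4 ^ m - 4 ^ μ - 4 ^ (m - μ) + 1) + ((n / m : ℕ) : ℚ)⌉

/-- `t''_m`. -/
def slotC (n m μ : ℕ) : ℤ :=
  1 + ⌈((4 : ℚ) ^ n + 1 - 2 * 4 ^ (m - μ) - ((n / m : ℕ) : ℚ) * (4 ^ m - 1))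
      / (((n / m : ℕ) : ℚ) * (4 ^ m - 4 ^ μ - 4 ^ (m - μ) + 1))⌉

/-- The exact outcome of the parameter count with `k` overheads of `μ` qubits. -/
def gateExact (n m μ k : ℕ) : ℤ :=
  ⌈((4 : ℚ) ^ n - 1 - (k : ℚ) * (4 ^ μ - 1) - ((n / m : ℕ) : ℚ) * (4 ^ m - 1))
      / (4 ^ m - 4 ^ μ - 4 ^ (m - μ) + 1) + ((n / m : ℕ) : ℚ)⌉

/-- The number of time slots that belongs to `gateExact`. -/
def slotExact (n m μ k : ℕ) : ℤ :=
  1 + ⌈((4 : ℚ) ^ n - 1 - (k : ℚ) * (4 ^ μ - 1) - ((n / m : ℕ) : ℚ) * (4 ^ m - 1))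
      / (((n / m : ℕ) : ℚ) * (4 ^ m - 4 ^ μ - 4 ^ (m - μ) + 1))⌉

/-! ### Circuits -/

/-- The operator on `n` qubits that applies `U` to the qubits in `S` and the identity to the
others. Basis states are bit strings `Fin n → Fin 2`. -/
def embedGate {n : ℕ} (S : Finset (Fin n)) (U : Matrix (S → Fin 2) (S → Fin 2) ℂ) :
    Matrix (Fin n → Fin 2) (Fin n → Fin 2) ℂ :=
  Matrix.of fun x y =>
    if ∀ i, i ∉ S → x i = y i then U (fun i => x i) (fun i => y i) else 0

/-- The circuit whose `i`-th gate acts on the qubits in `S i` implements `u` exactly for a suitable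
choice of the gates; the gate with index `0` is applied first. Gates are taken from the full
unitary group, so that global phases of gates do not matter. -/
def Implements {n N : ℕ} (S : Fin N → Finset (Fin n))
    (u : specialUnitaryGroup (Fin n → Fin 2) ℂ) : Prop :=
  ∃ U : ∀ i : Fin N, unitaryGroup (S i → Fin 2) ℂ,
    (u : Matrix (Fin n → Fin 2) (Fin n → Fin 2) ℂ)
      = (List.ofFn fun i => embedGate (S i) (U i : Matrix (S i → Fin 2) (S i → Fin 2) ℂ)).reverse.prod

/-- No gate before the `i`-th one touches the qubits in `A`. -/
def Fresh {n N : ℕ} (S : Fin N → Finset (Fin n)) (i : Fin N) (A : Finset (Fin n)) : Prop :=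
  ∀ j, j < i → Disjoint A (S j)

/-- Some gate before the `i`-th one acts on all qubits in `A`, and no gate in between touches any
of them: the `i`-th gate is adjacent to that gate and overlaps with it in `A`. -/
def Overlaps {n N : ℕ} (S : Fin N → Finset (Fin n)) (i : Fin N) (A : Finset (Fin n)) : Prop :=
  ∃ j, j < i ∧ A ⊆ S j ∧ ∀ l, j < l → l < i → Disjoint A (S l)

/-- A network of `N` gates of `m` qubits each in `T` time slots on `n` qubits, with block overlap
`μ`. Gates in one time slot act in parallel. The first slot is filled with `⌊n/m⌋` parallel gates
(unless there are no further slots in use). Each later gate overlaps with two adjacent previous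
gates in `m - μ` and in `μ` qubits; at the rim of the register the `μ` qubits may instead be an
overhead, not touched before. -/
structure ModuleNetwork (n m μ N T : ℕ) where
  support : Fin N → Finset (Fin n)
  card_support : ∀ i, (support i).card = m
  slot : Fin N → Fin T
  slot_mono : Monotone slot
  parallel : ∀ i j, i ≠ j → slot i = slot j → Disjoint (support i) (support j)
  first_slot : (∃ i, (slot i : ℕ) ≠ 0) →
    (Finset.univ.filter fun i => (slot i : ℕ) = 0).card = n / m
  later_slots : ∀ i, (slot i : ℕ) ≠ 0 → ∃ A B : Finset (Fin n),
    Disjoint A B ∧ A ∪ B = support i ∧ A.card = μ ∧ B.card = m - μ ∧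
      Overlaps support i B ∧ (Overlaps support i A ∨ Fresh support i A)

/-! ### Generic unitaries -/

/-- The Borel sigma-algebra of `SU(2^n)`. -/
instance (n : ℕ) : MeasurableSpace (specialUnitaryGroup (Fin n → Fin 2) ℂ) := borel _

instance (n : ℕ) : BorelSpace (specialUnitaryGroup (Fin n → Fin 2) ℂ) := ⟨rfl⟩

/-- `P` holds for a generic element of `SU(2^n)`: on an open dense set whose complement is null for
Haar measure. -/
def Generic (n : ℕ) (P : specialUnitaryGroup (Fin n → Fin 2) ℂ → Prop) : Prop :=
  ∃ O : Set (specialUnitaryGroup (Fin n → Fin 2) ℂ), IsOpen O ∧ Dense O ∧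
    (∀ ν : Measure (specialUnitaryGroup (Fin n → Fin 2) ℂ), ν.IsHaarMeasure → ν Oᶜ = 0) ∧
    ∀ u ∈ O, P u

end

/-! Fix the qubit sets of the gates of a circuit. The unitaries it reaches form a compact set, and
the task is to cover this set by countably many C¹ images of ℝ^p with `p` small. A gate on `S`
factors as `v * (a * b)`, where `a` and `b` are gates on disjoint `A, B ⊆ S` and `v` runs through a
family with `4^|S| + 1 - 4^|A| - 4^|B|` parameters (`exists_isParam_gate`). If the gate overlaps
with an adjacent previous gate on `A`, then `a` commutes back to that gate and merges with it;
likewise for `b`. So only the parameters of `v` count, plus one global phase (`isParam_circuitSet`).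
A part without overlap is replaced by the empty set.

If `p < 4^n = dim U(2^n)`, the reached set has too small a Hausdorff dimension, and its trace on
`SU(2^n)` is Haar null (`haar_eq_zero_of_isParam`). Only finitely many patterns have fewer than a
given number of gates, so the complement of their union is open, dense and of full measure
(`generic_of_circuits`).

The rest is counting. The supports in the first slot and the overheads are pairwise disjoint, so
once later slots are in use the overheads comprise at most `n % m = k * μ` qubits; comparison with
`4^n` gives the gate bound (`ModuleNetwork.negligible_support`). A slot holds at most `n / m` gates,
which gives the slot bound. The remaining bounds compare formulas; the delicate case is
`gateC_half_le_gateExact`. For two-qubit gates overlaps on single qubits are automatic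
(`overlaps_singleton`), so no network structure is needed. -/

noncomputable section

/-! ### Sets covered by countably many C¹ images of ℝ^p. -/

section Parametrization

open Set NormedSpace

/-- `E` is covered by countably many images of continuously differentiable maps of `p` real
parameters. -/
def IsParam {M : Type*} [NormedAddCommGroup M] [NormedSpace ℝ M] (p : ℕ) (E : Set M) : Prop :=
  ∃ F : Set ((Fin p → ℝ) → M), F.Countable ∧ (∀ f ∈ F, ContDiff ℝ 1 f) ∧ E ⊆ ⋃ f ∈ F, range f

namespace IsParam

variable {M M' : Type*} [NormedAddCommGroup M] [NormedSpace ℝ M]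
  [NormedAddCommGroup M'] [NormedSpace ℝ M']

theorem mono {p : ℕ} {E E' : Set M} (h : IsParam p E) (hE : E' ⊆ E) : IsParam p E' := by
  obtain ⟨F, hF, hc, hcov⟩ := h
  exact ⟨F, hF, hc, hE.trans hcov⟩

theorem mono_dim {p r : ℕ}
    {E : Set M} (h : IsParam p E) (hpr : p ≤ r) : IsParam r E := by
  obtain ⟨F, hF, hc, hcov⟩ := h
  refine ⟨(fun f (x : Fin r → ℝ) => f fun i => x (Fin.castLE hpr i)) '' F, hF.image _, ?_, ?_⟩
  · rintro _ ⟨f, hf, rfl⟩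
    exact (hc f hf).comp (by fun_prop)
  · intro e he
    obtain ⟨f, hf, y, rfl⟩ := by simpa using hcov he
    refine mem_biUnion (mem_image_of_mem _ hf)
      ⟨fun i => if hi : (i : ℕ) < p then y ⟨i, hi⟩ else 0, ?_⟩
    simp

theorem image {p : ℕ} {E : Set M} (h : IsParam p E) {φ : M → M'} (hφ : ContDiff ℝ 1 φ) :
    IsParam p (φ '' E) := by
  obtain ⟨F, hF, hc, hcov⟩ := h
  refine ⟨(fun f => φ ∘ f) '' F, hF.image _, ?_, ?_⟩
  · rintro _ ⟨f, hf, rfl⟩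
    exact hφ.comp (hc f hf)
  · rintro _ ⟨x, hx, rfl⟩
    obtain ⟨f, hf, y, rfl⟩ := by simpa using hcov hx
    simp only [mem_image, iUnion_exists, biUnion_and', iUnion_iUnion_eq_right, mem_iUnion]
    exact ⟨f, hf, y, rfl⟩

/-- C¹ maps do not raise Hausdorff dimension, and countable unions do not either. -/
theorem dimH_le {p : ℕ} {E : Set M} (h : IsParam p E) : dimH E ≤ p := by
  obtain ⟨F, hF, hc, hcov⟩ := h
  refine (dimH_mono hcov).trans ?_
  rw [dimH_bUnion hF]
  refine iSup₂_le fun f hf => ?_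
  simpa using (hc f hf).dimH_range_le

theorem mul {R : Type*} [NormedRing R] [NormedAlgebra ℝ R] {p r : ℕ} {E E' : Set R}
    (h : IsParam p E) (h' : IsParam r E') : IsParam (p + r) (image2 (· * ·) E E') := by
  obtain ⟨F, hF, hc, hcov⟩ := h
  obtain ⟨F', hF', hc', hcov'⟩ := h'
  refine ⟨image2 (fun f g (x : Fin (p + r) → ℝ) =>
    f (fun i => x (Fin.castAdd r i)) * g (fun i => x (Fin.natAdd p i))) F F', hF.image2 hF' _,
    ?_, ?_⟩
  · rintro _ ⟨f, hf, g, hg, rfl⟩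
    exact ((hc f hf).comp (by fun_prop)).mul ((hc' g hg).comp (by fun_prop))
  · rintro _ ⟨x, hx, y, hy, rfl⟩
    obtain ⟨f, hf, a, rfl⟩ := by simpa using hcov hx
    obtain ⟨g, hg, b, rfl⟩ := by simpa using hcov' hy
    refine mem_biUnion (mem_image2_of_mem hf hg) ⟨Fin.append a b, ?_⟩
    simp

end IsParam

/-! ### Exponential coordinates on the unitary group modulo a subgroup. -/

section Cover

variable {R : Type*} [NormedRing R] [NormedAlgebra ℝ R] [CompleteSpace R]

theorem contDiff_normedSpace_exp : ContDiff ℝ 1 (exp : R → R) :=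
  contDiff_iff_contDiffAt.2 fun x => (exp_analytic (𝕂 := ℝ) x).contDiffAt

/-- Near zero the exponential does not contract distances by more than a constant. -/
theorem exists_antilipschitz_exp :
    ∃ V : Set R, IsOpen V ∧ 0 ∈ V ∧ ∃ K : NNReal,
      AntilipschitzWith K (V.domRestrict (exp : R → R)) := by
  have h : HasStrictFDerivAt (exp : R → R)
      ((ContinuousLinearEquiv.refl ℝ R : R ≃L[ℝ] R) : R →L[ℝ] R) 0 := hasStrictFDerivAt_exp_zero
  obtain ⟨V, h0, hV, hA⟩ := h.approximates_deriv_on_open_nhds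
  exact ⟨V, hV, h0, _, hA.antilipschitz
    ((ContinuousLinearEquiv.refl ℝ R).subsingleton_or_nnnorm_symm_pos.imp id fun hf' =>
      NNReal.half_lt_self <| ne_of_gt <| inv_pos.2 hf')⟩

variable [StarRing R] [ContinuousStar R] [StarModule ℝ R] [FiniteDimensional ℝ R]

/-- If `𝔭` and `𝔥` span the skew-adjoint elements, the unitaries near `1` are products of an
exponential from `𝔭` and one from `𝔥`. -/
theorem exists_nhds_one_eq_exp_mul_exp (𝔭 𝔥 : Submodule ℝ R)
    (hsup : 𝔭 ⊔ 𝔥 = skewAdjoint.submodule ℝ R) :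
    ∃ V ∈ nhds (1 : R), ∀ w ∈ V, w ∈ unitary R → ∃ X ∈ 𝔭, ∃ Y ∈ 𝔥, w = exp X * exp Y := by
  let _ : NormedAlgebra ℚ R := NormedAlgebra.restrictScalars ℚ ℝ R
  let 𝔰 := selfAdjoint.submodule ℝ R
  -- A third, self-adjoint factor makes the derivative at 0 surjective onto all of `R`, so that `Φ`
  -- is open there. It is shown at the end that this factor is trivial when the product is unitary.
  let Φ : 𝔭 × 𝔥 × 𝔰 → R := fun z => exp (z.1 : R) * (exp (z.2.1 : R) * exp (z.2.2 : R))
  let L₁ : 𝔭 × 𝔥 × 𝔰 →L[ℝ] R := 𝔭.subtypeL ∘L ContinuousLinearMap.fst ℝ _ _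
  let L₂ : 𝔭 × 𝔥 × 𝔰 →L[ℝ] R :=
    𝔥.subtypeL ∘L ContinuousLinearMap.fst ℝ _ _ ∘L ContinuousLinearMap.snd ℝ _ _
  let L₃ : 𝔭 × 𝔥 × 𝔰 →L[ℝ] R :=
    𝔰.subtypeL ∘L ContinuousLinearMap.snd ℝ _ _ ∘L ContinuousLinearMap.snd ℝ _ _
  have hexp (L : 𝔭 × 𝔥 × 𝔰 →L[ℝ] R) : HasStrictFDerivAt (fun z => exp (L z)) L 0 := by
    have h : HasStrictFDerivAt (exp : R → R) (1 : R →L[ℝ] R) (L 0) := by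
      rw [map_zero]; exact hasStrictFDerivAt_exp_zero
    exact h.comp (0 : 𝔭 × 𝔥 × 𝔰) L.hasStrictFDerivAt
  have hΦ : HasStrictFDerivAt Φ (L₁ + (L₂ + L₃)) 0 := by
    have := (hexp L₁).mul' ((hexp L₂).mul' (hexp L₃))
    refine this.congr_fderiv ?_
    refine ContinuousLinearMap.ext fun z => ?_
    simp [add_comm]
  have hsurj : (L₁ + (L₂ + L₃)).range = ⊤ := by
    rw [LinearMap.range_eq_top]
    intro w
    have hskew : ((skewAdjointPart ℝ w : skewAdjoint R) : R) ∈ 𝔭 ⊔ 𝔥 := by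
      rw [hsup]; exact (skewAdjointPart ℝ w).2
    obtain ⟨X, hX, Y, hY, hXY⟩ := Submodule.mem_sup.1 hskew
    refine ⟨(⟨X, hX⟩, ⟨Y, hY⟩, ⟨selfAdjointPart ℝ w, (selfAdjointPart ℝ w).2⟩), ?_⟩
    change X + (Y + (selfAdjointPart ℝ w : R)) = w
    rw [← add_assoc, hXY, add_comm]
    exact StarModule.selfAdjointPart_add_skewAdjointPart ℝ w
  obtain ⟨V, hVo, h0V, K, hK⟩ := exists_antilipschitz_exp (R := R)
  have hV : V ∈ nhds (0 : R) := hVo.mem_nhds h0V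
  have hinj : InjOn (exp : R → R) V := injOn_iff_injective.2 hK.injective
  have hW : {z : 𝔭 × 𝔥 × 𝔰 | (z.2.2 : R) ∈ V ∧ -(z.2.2 : R) ∈ V} ∈ nhds (0 : 𝔭 × 𝔥 × 𝔰) := by
    have h₁ : Filter.Tendsto L₃ (nhds 0) (nhds 0) := by
      simpa using L₃.continuous.tendsto 0
    have h₂ : Filter.Tendsto (fun z => -L₃ z) (nhds 0) (nhds 0) := by
      simpa using h₁.neg
    exact Filter.inter_mem (h₁ hV) (h₂ hV)
  have hmap := hΦ.map_nhds_eq_of_surj hsurj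
  have h1 : Φ 0 = 1 := by simp [Φ]
  rw [h1] at hmap
  refine ⟨Φ '' _, hmap ▸ Filter.image_mem_map hW, ?_⟩
  rintro _ ⟨⟨X, Y, P⟩, ⟨hP, hP'⟩, rfl⟩ hw
  refine ⟨X, X.2, Y, Y.2, ?_⟩
  have hle (Z : R) (hZ : Z ∈ 𝔭 ⊔ 𝔥) : exp Z ∈ unitary R :=
    exp_mem_unitary_of_mem_skewAdjoint (by rw [hsup] at hZ; exact hZ)
  have hXu := hle X (le_sup_left (a := 𝔭) X.2)
  have hYu := hle Y (le_sup_right (a := 𝔭) Y.2)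
  have hPu : exp (P : R) ∈ unitary R := by
    have : exp (P : R) = star (exp (Y : R)) * (star (exp (X : R)) * Φ (X, Y, P)) := by
      simp only [Φ]
      rw [← mul_assoc (star (exp (X : R))), hXu.1, one_mul, ← mul_assoc, hYu.1, one_mul]
    rw [this]
    exact mul_mem (Unitary.star_mem hYu) (mul_mem (Unitary.star_mem hXu) hw)
  have hPs : star (exp (P : R)) = exp (P : R) := by
    rw [star_exp, show star (P : R) = P from P.2]
  -- `exp P` is both unitary and self-adjoint, hence an involution, so `exp P = exp (-P)`.
  -- Injectivity of `exp` on `V`, which contains `P` and `-P`, forces `P = 0`.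
  have hPP : exp (P : R) * exp (P : R) = 1 := by
    have := hPu.1
    rwa [hPs] at this
  have hneg : exp (P : R) = exp (-(P : R)) := by
    have h2 : exp (P : R) * exp (-(P : R)) = 1 := by
      rw [← NormedSpace.exp_add_of_commute (Commute.neg_right (Commute.refl _))]; simp
    calc exp (P : R) = exp (P : R) * (exp (P : R) * exp (-(P : R))) := by rw [h2, mul_one]
      _ = exp (-(P : R)) := by rw [← mul_assoc, hPP, one_mul]
  have h0 : (P : R) = 0 := by
    have h2 : (2 : ℝ) • (P : R) = 0 := by
      rw [two_smul]
      exact add_eq_zero_iff_eq_neg.2 (hinj hP hP' hneg)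
    exact (smul_eq_zero.1 h2).resolve_left two_ne_zero
  simp [Φ, h0]

/-- The unitaries modulo the subgroup with Lie algebra `𝔥` have `dim 𝔲 - dim 𝔥` parameters. -/
theorem exists_isParam_unitary (𝔥 : Submodule ℝ R) (hh : 𝔥 ≤ skewAdjoint.submodule ℝ R) :
    ∃ V : Set R, IsParam (Module.finrank ℝ (skewAdjoint.submodule ℝ R) - Module.finrank ℝ 𝔥) V ∧
      ∀ w ∈ unitary R, ∃ v ∈ V, ∃ Y ∈ 𝔥, w = v * exp Y := by
  obtain ⟨𝔭, h𝔭, h𝔭', hdisj⟩ : ∃ 𝔭 : Submodule ℝ R, 𝔭 ≤ skewAdjoint.submodule ℝ R ∧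
      𝔭 ⊔ 𝔥 = skewAdjoint.submodule ℝ R ∧ Disjoint 𝔭 𝔥 := by
    obtain ⟨𝔠, h𝔠⟩ := Submodule.exists_isCompl 𝔥
    refine ⟨skewAdjoint.submodule ℝ R ⊓ 𝔠, inf_le_left, ?_, ?_⟩
    · rw [inf_sup_assoc_of_le _ hh, sup_comm, h𝔠.sup_eq_top, inf_top_eq]
    · exact h𝔠.disjoint.symm.mono_left inf_le_right
  have hdim : Module.finrank ℝ 𝔭 =
      Module.finrank ℝ (skewAdjoint.submodule ℝ R) - Module.finrank ℝ 𝔥 := by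
    have := Submodule.finrank_sup_add_finrank_inf_eq 𝔭 𝔥
    rw [h𝔭', hdisj.eq_bot, finrank_bot] at this
    omega
  rw [← hdim]
  obtain ⟨N, hN, hNw⟩ := exists_nhds_one_eq_exp_mul_exp 𝔭 𝔥 h𝔭'
  have : SecondCountableTopology R := by
    have := FiniteDimensional.proper_real R
    infer_instance
  have hcov (g : unitary R) : {x : unitary R | (star g * x : R) ∈ N} ∈ nhds g := by
    have hc : Continuous fun x : unitary R => (star g * x : R) := by fun_prop
    refine hc.continuousAt ?_
    simpa using hN
  -- Countably many left translates of the neighbourhood of 1 cover the group.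
  obtain ⟨s, hs, hsu⟩ := TopologicalSpace.countable_cover_nhds hcov
  let e : (Fin (Module.finrank ℝ 𝔭) → ℝ) →ₗ[ℝ] R :=
    𝔭.subtype ∘ₗ (Module.finBasis ℝ 𝔭).equivFun.symm.toLinearMap
  have he : ContDiff ℝ 1 e := e.toContinuousLinearMap.contDiff
  let f : unitary R → (Fin (Module.finrank ℝ 𝔭) → ℝ) → R := fun g x => g * exp (e x)
  refine ⟨⋃ g ∈ s, range (f g), ⟨f '' s, hs.image _, ?_, ?_⟩, ?_⟩
  · rintro _ ⟨g, -, rfl⟩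
    exact contDiff_const.mul (contDiff_normedSpace_exp.comp he)
  · rw [biUnion_image]
  · intro w hw
    obtain ⟨g, hg, hgw⟩ := mem_iUnion₂.1 (hsu ▸ mem_univ (⟨w, hw⟩ : unitary R))
    obtain ⟨X, hX, Y, hY, hXY⟩ := hNw _ hgw (mul_mem (star g).2 hw)
    refine ⟨g * exp X, mem_iUnion₂.2 ⟨g, hg, (Module.finBasis ℝ 𝔭).equivFun ⟨X, hX⟩, ?_⟩,
      Y, hY, ?_⟩
    · change (g : R) * exp (((Module.finBasis ℝ 𝔭).equivFun.symm
        ((Module.finBasis ℝ 𝔭).equivFun ⟨X, hX⟩) : 𝔭) : R) = g * exp X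
      rw [LinearEquiv.symm_apply_apply]
    · rw [mul_assoc, ← hXY, ← mul_assoc]
      simp

end Cover
end Parametrization

/-! ### Few parameters imply Haar measure zero. -/

section HaarNull

open Set NormedSpace
open scoped Matrix.Norms.L2Operator

variable {ι : Type*} [Fintype ι] [DecidableEq ι]

/-- Multiplication by `i` exchanges self-adjoint and skew-adjoint matrices, so each takes half of
the real dimension `2 d²`. -/
theorem finrank_skewAdjoint_matrix :
    Module.finrank ℝ (skewAdjoint.submodule ℝ (Matrix ι ι ℂ)) = Fintype.card ι ^ 2 := by
  have h1 : Module.finrank ℝ (Matrix ι ι ℂ) = Fintype.card ι * Fintype.card ι * 2 := by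
    rw [Module.finrank_matrix, Complex.finrank_real_complex]
  have h2 := (StarModule.decomposeProdAdjoint ℝ (Matrix ι ι ℂ)).finrank_eq
  have h3 : Module.finrank ℝ (selfAdjoint.submodule ℝ (Matrix ι ι ℂ)) =
      Module.finrank ℝ (skewAdjoint.submodule ℝ (Matrix ι ι ℂ)) := by
    have hI : ∀ X : Matrix ι ι ℂ, star X = X → star (Complex.I • X) = -(Complex.I • X) := by
      intro X hX
      rw [star_smul, hX]; simp
    have hI' : ∀ X : Matrix ι ι ℂ, star X = -X → star (-Complex.I • X) = -Complex.I • X := by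
      intro X hX
      rw [star_smul, hX]; simp
    refine LinearEquiv.finrank_eq (LinearEquiv.ofLinearMap
      { toFun := fun X => ⟨Complex.I • (X : Matrix ι ι ℂ), hI X X.2⟩
        map_add' := fun X Y => Subtype.ext (smul_add _ _ _)
        map_smul' := fun c X => Subtype.ext (smul_comm _ _ _) }
      { toFun := fun X => ⟨-Complex.I • (X : Matrix ι ι ℂ), hI' X X.2⟩
        map_add' := fun X Y => Subtype.ext (smul_add _ _ _)
        map_smul' := fun c X => Subtype.ext (smul_comm _ _ _) } ?_ ?_)
    · refine LinearMap.ext fun X => Subtype.ext ?_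
      simp [smul_smul]
    · refine LinearMap.ext fun X => Subtype.ext ?_
      simp [smul_smul]
  have h4 := h2.trans (Module.finrank_prod (R := ℝ)
    (M := selfAdjoint.submodule ℝ (Matrix ι ι ℂ)) (M' := skewAdjoint.submodule ℝ (Matrix ι ι ℂ)))
  change _ = Module.finrank ℝ (selfAdjoint.submodule ℝ (Matrix ι ι ℂ)) +
    Module.finrank ℝ (skewAdjoint.submodule ℝ (Matrix ι ι ℂ)) at h4
  rw [sq]
  omega

theorem isCompact_unitaryGroup : IsCompact (unitaryGroup ι ℂ : Set (Matrix ι ι ℂ)) := by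
  refine Metric.isCompact_of_isClosed_isBounded ?_ ?_
  · have : (unitaryGroup ι ℂ : Set (Matrix ι ι ℂ)) = {A | A * star A = 1} := by
      ext A; exact mem_unitaryGroup_iff
    rw [this]
    exact isClosed_eq (by fun_prop) continuous_const
  · refine (Metric.isBounded_closedBall (x := (0 : Matrix ι ι ℂ)) (r := 1)).subset ?_
    intro A hA
    rw [mem_closedBall_zero_iff]
    rcases subsingleton_or_nontrivial (Matrix ι ι ℂ) with h | h
    · simp [Subsingleton.elim A 0]
    · exact (CStarRing.norm_of_mem_unitary hA).le

instance : CompactSpace (unitaryGroup ι ℂ) :=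
  isCompact_iff_compactSpace.1 isCompact_unitaryGroup

instance : CompactSpace (specialUnitaryGroup ι ℂ) := by
  refine isCompact_iff_compactSpace.1 (isCompact_unitaryGroup.of_isClosed_subset ?_
    specialUnitaryGroup_le_unitaryGroup)
  have : ((specialUnitaryGroup ι ℂ : Submonoid _) : Set (Matrix ι ι ℂ)) =
      (unitaryGroup ι ℂ : Set (Matrix ι ι ℂ)) ∩ {A : Matrix ι ι ℂ | A.det = 1} := by
    ext A; exact mem_specialUnitaryGroup_iff
  rw [this]
  exact isCompact_unitaryGroup.isClosed.inter
    (isClosed_eq (Continuous.matrix_det continuous_id) continuous_const)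

instance : IsTopologicalGroup (specialUnitaryGroup ι ℂ) where
  continuous_inv := by
    refine continuous_induced_rng.2 ?_
    exact continuous_star.comp continuous_subtype_val

/-- `I • Z` is Hermitian, so the spectral theorem reduces the claim to diagonal matrices. -/
theorem det_exp_of_skewAdjoint {Z : Matrix ι ι ℂ} (hZ : Z ∈ skewAdjoint (Matrix ι ι ℂ)) :
    (exp Z).det = Complex.exp Z.trace := by
  have hH : (Complex.I • Z).IsHermitian := by
    rw [IsHermitian, ← star_eq_conjTranspose, star_smul, skewAdjoint.mem_iff.1 hZ]
    simp
  set U := hH.eigenvectorUnitary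
  set v : ι → ℂ := fun i => -Complex.I * hH.eigenvalues i
  have hU : (U : Matrix ι ι ℂ) * star (U : Matrix ι ι ℂ) = 1 := U.2.2
  have hspec : Z = U * diagonal v * star (U : Matrix ι ι ℂ) := by
    have h := hH.spectral_theorem
    rw [Unitary.conjStarAlgAut_apply] at h
    have hv : diagonal v = -Complex.I • diagonal (RCLike.ofReal ∘ hH.eigenvalues : ι → ℂ) := by
      ext i j
      by_cases hij : i = j <;> simp [v, hij]
    rw [hv, mul_smul_comm, smul_mul_assoc, ← h, smul_smul]
    simp
  have hexp : exp Z = U * exp (diagonal v) * star (U : Matrix ι ι ℂ) := by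
    conv_lhs => rw [hspec]
    exact Matrix.exp_units_conj (Unitary.toUnits U) (diagonal v)
  have hU' : star (U : Matrix ι ι ℂ) * (U : Matrix ι ι ℂ) = 1 := U.2.1
  have htr : Z.trace = ∑ i, v i := by
    rw [hspec, trace_mul_comm, ← mul_assoc, hU', one_mul, trace_diagonal]
  rw [hexp, det_mul_right_comm, hU, one_mul, Matrix.exp_diagonal, det_diagonal, htr,
    Complex.exp_sum]
  refine Finset.prod_congr rfl fun i _ => ?_
  rw [Pi.exp_def, Complex.exp_eq_exp_ℂ]

/-- The exponential of the traceless part of a skew-adjoint matrix. -/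
def specialExp [Nonempty ι] (Z : skewAdjoint.submodule ℝ (Matrix ι ι ℂ)) :
    specialUnitaryGroup ι ℂ :=
  ⟨exp ((Z : Matrix ι ι ℂ) - ((Z : Matrix ι ι ℂ).trace / Fintype.card ι) • 1), by
    have hZ : star (Z : Matrix ι ι ℂ) = -Z := Z.2
    let _ : NormedAlgebra ℚ (Matrix ι ι ℂ) := NormedAlgebra.restrictScalars ℚ ℝ _
    have hW : (Z : Matrix ι ι ℂ) - ((Z : Matrix ι ι ℂ).trace / Fintype.card ι) • 1 ∈
        skewAdjoint (Matrix ι ι ℂ) := by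
      rw [skewAdjoint.mem_iff, star_sub, star_smul, hZ, star_div₀]
      have : star (Z : Matrix ι ι ℂ).trace = -(Z : Matrix ι ι ℂ).trace := by
        rw [← trace_conjTranspose, ← star_eq_conjTranspose, hZ, trace_neg]
      rw [this]
      simp [neg_div, sub_eq_add_neg, add_comm]
    refine mem_specialUnitaryGroup_iff.2 ⟨exp_mem_unitary_of_mem_skewAdjoint hW, ?_⟩
    · rw [det_exp_of_skewAdjoint hW, trace_sub, trace_smul, trace_one, smul_eq_mul,
        div_mul_cancel₀ _ (by simp), sub_self, Complex.exp_zero]⟩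

/-- The scalar part of `Z` contributes only a phase. Phase-invariant sets can therefore be tested
with the full exponential on `𝔲`. -/
theorem coe_specialExp [Nonempty ι] (Z : skewAdjoint.submodule ℝ (Matrix ι ι ℂ)) :
    ∃ z : ℂ, ‖z‖ = 1 ∧ exp (Z : Matrix ι ι ℂ) = z • (specialExp Z : Matrix ι ι ℂ) := by
  have hZ : star (Z : Matrix ι ι ℂ) = -Z := Z.2
  set c : ℂ := (Z : Matrix ι ι ℂ).trace / Fintype.card ι with hc
  refine ⟨Complex.exp c, ?_, ?_⟩
  · have h : star (Z : Matrix ι ι ℂ).trace = -(Z : Matrix ι ι ℂ).trace := by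
      rw [← trace_conjTranspose, ← star_eq_conjTranspose, hZ, trace_neg]
    have h0 : (Z : Matrix ι ι ℂ).trace.re = 0 := by
      have := congrArg Complex.re h
      simp only [RCLike.star_def, Complex.conj_re, Complex.neg_re] at this
      linarith
    rw [Complex.norm_exp, hc]
    simp [Complex.div_natCast_re, h0]
  · have hcomm : Commute (c • (1 : Matrix ι ι ℂ)) ((Z : Matrix ι ι ℂ) - c • 1) :=
      (Commute.one_left _).smul_left c
    have hs : exp (c • (1 : Matrix ι ι ℂ)) = Complex.exp c • 1 := by
      rw [smul_one_eq_diagonal, Matrix.exp_diagonal, smul_one_eq_diagonal, Complex.exp_eq_exp_ℂ]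
      congr 1
      ext i
      exact congrFun (Pi.exp_def (fun _ : ι => c)) i
    have := Matrix.exp_add_of_commute _ _ hcomm
    rw [add_sub_cancel, hs, smul_one_mul] at this
    exact this

theorem continuous_specialExp [Nonempty ι] : Continuous (specialExp (ι := ι)) := by
  let _ : NormedAlgebra ℚ (Matrix ι ι ℂ) := NormedAlgebra.restrictScalars ℚ ℝ _
  refine continuous_induced_rng.2 (exp_continuous.comp ?_)
  fun_prop

/-- A phase-invariant set with fewer parameters than the unitary group meets the special unitary
group in a set of Haar measure zero. -/
theorem haar_eq_zero_of_isParam [Nonempty ι] [MeasurableSpace (specialUnitaryGroup ι ℂ)]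
    [BorelSpace (specialUnitaryGroup ι ℂ)] {C : Set (Matrix ι ι ℂ)} {p : ℕ} (hC : IsParam p C)
    (hp : p < Fintype.card ι ^ 2) (hphase : ∀ z : ℂ, ‖z‖ = 1 → ∀ x ∈ C, z • x ∈ C)
    (ν : Measure (specialUnitaryGroup ι ℂ)) [ν.IsHaarMeasure] {E : Set (specialUnitaryGroup ι ℂ)}
    (hE : IsClosed E) (hEC : ∀ u ∈ E, (u : Matrix ι ι ℂ) ∈ C) : ν E = 0 := by
  let 𝔲 := skewAdjoint.submodule ℝ (Matrix ι ι ℂ)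
  let _ : MeasurableSpace 𝔲 := borel 𝔲
  have _ : BorelSpace 𝔲 := ⟨rfl⟩
  let D := Module.finrank ℝ 𝔲
  let ρ : Measure 𝔲 := Measure.hausdorffMeasure D
  have hρ : ρ.IsAddHaarMeasure := isAddHaarMeasure_hausdorffMeasure
  have : SecondCountableTopology (specialUnitaryGroup ι ℂ) := by
    have := FiniteDimensional.proper_real (Matrix ι ι ℂ)
    have : SecondCountableTopology (Matrix ι ι ℂ) := inferInstance
    exact TopologicalSpace.Subtype.secondCountableTopology _
  have : SecondCountableTopology 𝔲 := by
    have := FiniteDimensional.proper_real 𝔲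
    infer_instance
  obtain ⟨V, hVo, h0V, K, hK⟩ := exists_antilipschitz_exp (R := Matrix ι ι ℂ)
  let V' : Set 𝔲 := (↑) ⁻¹' V
  have hV' : IsOpen V' := hVo.preimage continuous_subtype_val
  -- Fubini for `A`, with `Z` restricted to `V'`. For fixed `g` the slice is null because its
  -- Hausdorff dimension is below `D`; for fixed `Z` the slice has measure `ν E` by left invariance.
  -- As `V'` has positive measure, `ν E = 0`.
  let A : Set (𝔲 × specialUnitaryGroup ι ℂ) := {x | specialExp x.1 * x.2 ∈ E}
  have hA : MeasurableSet A := by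
    refine IsClosed.measurableSet (hE.preimage ?_)
    exact (continuous_specialExp.comp continuous_fst).mul continuous_snd
  have hslice (g : specialUnitaryGroup ι ℂ) :
      (ρ.restrict V') ((fun Z => (Z, g)) ⁻¹' A) = 0 := by
    rw [Measure.restrict_apply (hA.preimage measurable_prodMk_right)]
    set C' : Set (Matrix ι ι ℂ) := (fun x => x * star (g : Matrix ι ι ℂ)) '' C
    have hC' : IsParam p C' := hC.image (contDiff_id.mul contDiff_const)
    set B : Set 𝔲 := (fun Z => (Z, g)) ⁻¹' A ∩ V'
    have hB : (↑) '' B ⊆ ((↑) '' ((V.domRestrict (exp : Matrix ι ι ℂ → Matrix ι ι ℂ)) ⁻¹' C') :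
        Set (Matrix ι ι ℂ)) := by
      rintro _ ⟨Z, ⟨hZA, hZV⟩, rfl⟩
      refine ⟨⟨Z, hZV⟩, ?_, rfl⟩
      obtain ⟨z, hz, hzZ⟩ := coe_specialExp Z
      refine ⟨z • (specialExp Z * g : specialUnitaryGroup ι ℂ).1, hphase z hz _ (hEC _ hZA), ?_⟩
      have hg : (g : Matrix ι ι ℂ) * star (g : Matrix ι ι ℂ) = 1 :=
        mem_unitaryGroup_iff.1 (specialUnitaryGroup_le_unitaryGroup g.2)
      simp only [domRestrict_apply, hzZ, Submonoid.coe_mul, smul_mul_assoc]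
      rw [mul_assoc, hg, mul_one]
    have hdim : dimH B ≤ p := by
      rw [← (isometry_subtype_coe (s := (𝔲 : Set (Matrix ι ι ℂ)))).dimH_image B]
      refine (dimH_mono hB).trans ?_
      -- Preimages under the antilipschitz restriction of `exp` to `V` do not gain dimension.
      rw [(isometry_subtype_coe (s := V)).dimH_image]
      exact (hK.dimH_preimage_le _).trans hC'.dimH_le
    have hlt : dimH B < ((D : NNReal) : ENNReal) := by
      refine hdim.trans_lt ?_
      rw [ENNReal.coe_natCast]
      exact_mod_cast hp.trans_eq finrank_skewAdjoint_matrix.symm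
    have := hausdorffMeasure_of_dimH_lt hlt
    simpa [ρ] using this
  have hprod : ((ρ.restrict V').prod ν) A = 0 := by
    rw [← Measure.prod_swap, Measure.map_apply measurable_swap hA,
      Measure.measure_prod_null (hA.preimage measurable_swap)]
    exact Filter.Eventually.of_forall hslice
  rw [Measure.measure_prod_null hA] at hprod
  have hconst (Z : 𝔲) : ν (Prod.mk Z ⁻¹' A) = ν E := measure_preimage_mul ν (specialExp Z) E
  simp only [hconst] at hprod
  have hne : (ρ.restrict V') ≠ 0 := by
    rw [Ne, Measure.restrict_eq_zero]
    exact (hV'.measure_pos ρ ⟨0, h0V⟩).ne'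
  have : (ae (ρ.restrict V')).NeBot := ae_neBot.2 hne
  exact hprod.exists.choose_spec

end HaarNull

/-! ### Gates as operators on all qubits, and their Lie algebras. -/

section GateHom

open scoped Matrix.Norms.L2Operator

variable {n : ℕ}

/-- Reduces the homomorphism laws of the embedding to those of the Kronecker product. -/
theorem embedGate_eq_submatrix (S : Finset (Fin n)) (U : Matrix (S → Fin 2) (S → Fin 2) ℂ) :
    embedGate S U =
      (U ⊗ₖ (1 : Matrix ({i // i ∉ S} → Fin 2) ({i // i ∉ S} → Fin 2) ℂ)).submatrix
        (Equiv.piEquivPiSubtypeProd (· ∈ S) fun _ => Fin 2)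
        (Equiv.piEquivPiSubtypeProd (· ∈ S) fun _ => Fin 2) := by
  ext x y
  have h : (∀ i, i ∉ S → x i = y i) ↔
      (fun i : {i // i ∉ S} => x i) = (fun i : {i // i ∉ S} => y i) := by
    simp [funext_iff]
  simp [embedGate, Matrix.one_apply, h]

/-- Gates on the qubits in `S` as operators on all qubits. -/
def gateHom (S : Finset (Fin n)) :
    Matrix (S → Fin 2) (S → Fin 2) ℂ →⋆ₐ[ℂ] Matrix (Fin n → Fin 2) (Fin n → Fin 2) ℂ where
  toFun := embedGate S
  map_one' := by rw [embedGate_eq_submatrix]; simp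
  map_mul' U V := by
    simp only [embedGate_eq_submatrix]
    rw [submatrix_mul_equiv, ← mul_kronecker_mul, one_mul]
  map_zero' := by rw [embedGate_eq_submatrix]; simp
  map_add' U V := by simp only [embedGate_eq_submatrix, add_kronecker]; rfl
  commutes' c := by
    simp only [embedGate_eq_submatrix, Algebra.algebraMap_eq_smul_one, smul_kronecker]
    rw [one_kronecker_one]
    exact congrArg (fun X : Matrix (Fin n → Fin 2) (Fin n → Fin 2) ℂ => c • X)
      (submatrix_one_equiv _)
  map_star' U := by
    simp only [embedGate_eq_submatrix, star_eq_conjTranspose, conjTranspose_submatrix,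
      conjTranspose_kronecker, conjTranspose_one]

theorem gateHom_apply (S : Finset (Fin n)) (U : Matrix (S → Fin 2) (S → Fin 2) ℂ)
    (x y : Fin n → Fin 2) :
    gateHom S U x y = if ∀ i, i ∉ S → x i = y i then U (fun i => x i) (fun i => y i) else 0 :=
  rfl

theorem gateHom_injective (S : Finset (Fin n)) : Function.Injective (gateHom S) := by
  intro U V h
  ext a b
  have := congrFun (congrFun h fun i => if hi : i ∈ S then a ⟨i, hi⟩ else 0)
    fun i => if hi : i ∈ S then b ⟨i, hi⟩ else 0
  rw [gateHom_apply, gateHom_apply, if_pos (by intro i hi; simp [hi]),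
    if_pos (by intro i hi; simp [hi])] at this
  simpa using this

theorem exists_gateHom_eq_of_subset {A S : Finset (Fin n)} (h : A ⊆ S)
    (U : Matrix (A → Fin 2) (A → Fin 2) ℂ) : ∃ V, gateHom S V = gateHom A U := by
  refine ⟨Matrix.of fun x y => if ∀ i : S, (i : Fin n) ∉ A → x i = y i then
    U (fun i => x ⟨i, h i.2⟩) (fun i => y ⟨i, h i.2⟩) else 0, ?_⟩
  ext x y
  simp only [gateHom_apply, of_apply, ← ite_and]
  refine if_congr ⟨?_, ?_⟩ rfl rfl
  · rintro ⟨h1, h2⟩ i hi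
    by_cases hS : i ∈ S
    · exact h2 ⟨i, hS⟩ hi
    · exact h1 i hS
  · intro h1
    exact ⟨fun i hi => h1 i fun hA => hi (h hA), fun i hi => h1 i hi⟩

theorem mem_unitary_of_gateHom {S : Finset (Fin n)} {U : Matrix (S → Fin 2) (S → Fin 2) ℂ}
    (h : gateHom S U ∈ unitary (Matrix (Fin n → Fin 2) (Fin n → Fin 2) ℂ)) :
    U ∈ unitary (Matrix (S → Fin 2) (S → Fin 2) ℂ) := by
  refine ⟨gateHom_injective S ?_, gateHom_injective S ?_⟩
  · rw [map_mul, map_star, map_one]; exact h.1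
  · rw [map_mul, map_star, map_one]; exact h.2

theorem exists_unitary_gateHom_eq_of_subset {A S : Finset (Fin n)} (h : A ⊆ S)
    {U : Matrix (A → Fin 2) (A → Fin 2) ℂ} (hU : U ∈ unitary _) :
    ∃ V ∈ unitary _, gateHom S V = gateHom A U := by
  obtain ⟨V, hV⟩ := exists_gateHom_eq_of_subset h U
  exact ⟨V, mem_unitary_of_gateHom (hV ▸ Unitary.map_mem (gateHom A) hU), hV⟩

theorem gateHom_mul_gateHom_apply {A B : Finset (Fin n)} (h : Disjoint A B)
    (U : Matrix (A → Fin 2) (A → Fin 2) ℂ) (V : Matrix (B → Fin 2) (B → Fin 2) ℂ)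
    (x y : Fin n → Fin 2) :
    (gateHom A U * gateHom B V) x y = if ∀ i, i ∉ A → i ∉ B → x i = y i then
      U (fun i => x i) (fun i => y i) * V (fun i => x i) (fun i => y i) else 0 := by
  have hdisj (i : Fin n) (hA : i ∈ A) (hB : i ∈ B) : False := Finset.disjoint_left.1 h hA hB
  -- The first factor can change only bits in `A`, the second only bits in `B`; so the intermediate
  -- string must agree with `y` on `A` and with `x` elsewhere.
  rw [Matrix.mul_apply, Finset.sum_eq_single fun i => if i ∈ A then y i else x i]
  · simp only [gateHom_apply]
    rw [if_pos (fun i hi => (if_neg hi).symm)]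
    have hzA : (fun i : A => if (i : Fin n) ∈ A then y i else x i) = fun i : A => y i :=
      funext fun i => if_pos i.2
    have hzB : (fun i : B => if (i : Fin n) ∈ A then y i else x i) = fun i : B => x i :=
      funext fun i => if_neg fun hA => hdisj i hA i.2
    rw [hzA, hzB]
    split_ifs with h1 h2 h2
    · rfl
    · exact absurd (fun i hA hB => by simpa [hA] using h1 i hB) h2
    · refine absurd (fun i hB => ?_) h1
      by_cases hA : i ∈ A
      · simp [hA]
      · simpa [hA] using h2 i hA hB
    · rw [mul_zero]
  · intro z _ hz
    simp only [gateHom_apply]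
    split_ifs with h1 h2
    · refine absurd (funext fun i => ?_) hz
      by_cases hA : i ∈ A
      · simpa [hA] using h2 i fun hB => hdisj i hA hB
      · simpa [hA] using (h1 i hA).symm
    all_goals simp
  · simp

theorem gateHom_commute {A B : Finset (Fin n)} (h : Disjoint A B)
    (U : Matrix (A → Fin 2) (A → Fin 2) ℂ) (V : Matrix (B → Fin 2) (B → Fin 2) ℂ) :
    Commute (gateHom A U) (gateHom B V) := by
  ext x y
  rw [gateHom_mul_gateHom_apply h, gateHom_mul_gateHom_apply h.symm]
  exact if_congr ⟨fun h i hA hB => h i hB hA, fun h i hA hB => h i hB hA⟩ (mul_comm _ _) rfl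

theorem gateHom_empty (U : Matrix ((∅ : Finset (Fin n)) → Fin 2) ((∅ : Finset (Fin n)) → Fin 2) ℂ) :
    gateHom ∅ U = U default default • 1 := by
  ext x y
  have : (∀ i, i ∉ (∅ : Finset (Fin n)) → x i = y i) ↔ x = y := by simp [funext_iff]
  rw [gateHom_apply, if_congr this rfl rfl, Matrix.smul_apply, Matrix.one_apply]
  rw [Subsingleton.elim (fun i : (∅ : Finset (Fin n)) => x i) default,
    Subsingleton.elim (fun i : (∅ : Finset (Fin n)) => y i) default]
  simp

/-- The Lie algebra of the gates on the qubits in `A`. -/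
def gateLie (A : Finset (Fin n)) :
    Submodule ℝ (Matrix (Fin n → Fin 2) (Fin n → Fin 2) ℂ) :=
  (skewAdjoint.submodule ℝ (Matrix (A → Fin 2) (A → Fin 2) ℂ)).map
    ((gateHom A).toLinearMap.restrictScalars ℝ)

theorem mem_gateLie {A : Finset (Fin n)} {X : Matrix (Fin n → Fin 2) (Fin n → Fin 2) ℂ} :
    X ∈ gateLie A ↔ ∃ Z ∈ skewAdjoint (Matrix (A → Fin 2) (A → Fin 2) ℂ), gateHom A Z = X :=
  Iff.rfl

theorem card_bitstrings_sq (A : Finset (Fin n)) : Fintype.card (A → Fin 2) ^ 2 = 4 ^ A.card := by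
  rw [Fintype.card_fun, Fintype.card_fin, Fintype.card_coe, ← pow_mul, mul_comm, pow_mul]
  norm_num

theorem finrank_gateLie (A : Finset (Fin n)) : Module.finrank ℝ (gateLie A) = 4 ^ A.card := by
  rw [gateLie, ← (Submodule.equivMapOfInjective _ (gateHom_injective A) _).finrank_eq,
    finrank_skewAdjoint_matrix, card_bitstrings_sq]

/-- An operator acting on `A` alone and also on the disjoint `B` alone is scalar, and
skew-adjointness leaves only `ℝ i`. The phases are thus all that the two Lie algebras share, whence
the `+ 1` in the cost of a gate. -/
theorem finrank_gateLie_inf_le {A B : Finset (Fin n)} (h : Disjoint A B) :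
    Module.finrank ℝ (gateLie A ⊓ gateLie B : Submodule ℝ _) ≤ 1 := by
  have hle : gateLie A ⊓ gateLie B ≤
      Submodule.span ℝ {Complex.I • (1 : Matrix (Fin n → Fin 2) (Fin n → Fin 2) ℂ)} := by
    rintro X ⟨hXA, hXB⟩
    obtain ⟨U, hU, rfl⟩ := mem_gateLie.1 hXA
    obtain ⟨V, -, hVU⟩ := mem_gateLie.1 hXB
    have hdiag (x y : Fin n → Fin 2) : gateHom A U x x = gateHom A U y y := by
      have h1 : gateHom A U x x = gateHom A U (fun i => if i ∈ A then x i else y i)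
          (fun i => if i ∈ A then x i else y i) := by
        simp only [gateHom_apply, implies_true, if_true]
        congr 1 <;> ext i <;> simp [i.2]
      rw [h1, ← hVU]
      simp only [gateHom_apply, implies_true, if_true]
      have (i : B) : (i : Fin n) ∉ A := fun hA => Finset.disjoint_left.1 h hA i.2
      congr 1 <;> ext i <;> simp [this i]
    have hoff (x y : Fin n → Fin 2) (hxy : x ≠ y) : gateHom A U x y = 0 := by
      by_contra hne
      have h1 : ∀ i, i ∉ A → x i = y i := by
        by_contra hc
        rw [gateHom_apply, if_neg hc] at hne
        exact hne rfl
      have h2 : ∀ i, i ∉ B → x i = y i := by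
        by_contra hc
        rw [← hVU, gateHom_apply, if_neg hc] at hne
        exact hne rfl
      refine hxy (funext fun i => ?_)
      by_cases hA : i ∈ A
      · exact h2 i fun hB => Finset.disjoint_left.1 h hA hB
      · exact h1 i hA
    have hskew : star (gateHom A U) = -gateHom A U := by
      rw [← map_star, skewAdjoint.mem_iff.1 hU, map_neg]
    have hre : (gateHom A U 0 0).re = 0 := by
      have h0 := congrFun (congrFun hskew 0) 0
      rw [star_apply, neg_apply] at h0
      have := congrArg Complex.re h0
      simp only [RCLike.star_def, Complex.conj_re, Complex.neg_re] at this
      linarith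
    refine Submodule.mem_span_singleton.2 ⟨(gateHom A U 0 0).im, ?_⟩
    ext x y
    by_cases hxy : x = y
    · subst hxy
      rw [hdiag x 0]
      apply Complex.ext <;> simp [hre]
    · rw [hoff x y hxy]
      simp [hxy]
  refine (Submodule.finrank_mono hle).trans ?_
  exact (finrank_span_le_card _).trans (by simp)

theorem le_finrank_gateLie_sup {A B : Finset (Fin n)} (h : Disjoint A B) :
    4 ^ A.card + 4 ^ B.card ≤ Module.finrank ℝ (gateLie A ⊔ gateLie B : Submodule ℝ _) + 1 := by
  have := Submodule.finrank_sup_add_finrank_inf_eq (gateLie A) (gateLie B)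
  rw [finrank_gateLie, finrank_gateLie] at this
  have := finrank_gateLie_inf_le h
  omega

theorem gateHom_exp (S : Finset (Fin n)) (U : Matrix (S → Fin 2) (S → Fin 2) ℂ) :
    gateHom S (NormedSpace.exp U) = NormedSpace.exp (gateHom S U) := by
  let _ : NormedAlgebra ℚ (Matrix (S → Fin 2) (S → Fin 2) ℂ) := NormedAlgebra.restrictScalars ℚ ℝ _
  exact NormedSpace.map_exp (gateHom S)
    ((gateHom S).toLinearMap.continuous_of_finiteDimensional) U

/-- Gates on `S`, up to gates on two disjoint parts `A` and `B` of `S` that act before them. -/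
theorem exists_isParam_gate {A B S : Finset (Fin n)} (hA : A ⊆ S) (hB : B ⊆ S)
    (hAB : Disjoint A B) :
    ∃ V : Set (Matrix (Fin n → Fin 2) (Fin n → Fin 2) ℂ),
      IsParam (4 ^ S.card + 1 - 4 ^ A.card - 4 ^ B.card) V ∧
      ∀ U ∈ unitary (Matrix (S → Fin 2) (S → Fin 2) ℂ), ∃ v ∈ V, ∃ a ∈ unitary _, ∃ b ∈ unitary _,
        gateHom S U = v * (gateHom A a * gateHom B b) := by
  let L := (gateHom S).toLinearMap.restrictScalars ℝ
  have hL : Function.Injective L := gateHom_injective S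
  have hle : gateLie A ⊔ gateLie B ≤ LinearMap.range L := by
    refine sup_le ?_ ?_ <;> rintro _ ⟨Z, -, rfl⟩
    · exact exists_gateHom_eq_of_subset hA Z
    · exact exists_gateHom_eq_of_subset hB Z
  have hskew : gateLie A ⊔ gateLie B ≤ skewAdjoint.submodule ℝ _ := by
    refine sup_le ?_ ?_ <;> rintro _ ⟨Z, hZ, rfl⟩
    · change star (gateHom A Z) = -gateHom A Z
      rw [← map_star, skewAdjoint.mem_iff.1 hZ, map_neg]
    · change star (gateHom B Z) = -gateHom B Z
      rw [← map_star, skewAdjoint.mem_iff.1 hZ, map_neg]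
  -- The directions to be divided out, seen inside the gates on `S`. The two summands commute, so
  -- the exponential of a sum splits into a gate on `A` and a gate on `B`.
  set 𝔥 := (gateLie A ⊔ gateLie B).comap L with h𝔥
  have hh : 𝔥 ≤ skewAdjoint.submodule ℝ _ := by
    intro X hX
    have h1 : star (gateHom S X) = -gateHom S X := hskew hX
    rw [← map_star, ← map_neg] at h1
    exact gateHom_injective S h1
  have hdim : Module.finrank ℝ 𝔥 = Module.finrank ℝ (gateLie A ⊔ gateLie B : Submodule ℝ _) := by
    rw [(Submodule.equivMapOfInjective L hL 𝔥).finrank_eq, h𝔥, Submodule.map_comap_eq_of_le hle]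
  obtain ⟨V, hV, hcov⟩ := exists_isParam_unitary 𝔥 hh
  refine ⟨gateHom S '' V, (hV.image ?_).mono_dim ?_, ?_⟩
  · exact L.toContinuousLinearMap.contDiff
  · have := le_finrank_gateLie_sup hAB
    rw [finrank_skewAdjoint_matrix, hdim]
    have hc := card_bitstrings_sq S
    omega
  · intro U hU
    obtain ⟨v, hv, Y, hY, rfl⟩ := hcov U hU
    obtain ⟨Y₁, h₁, Y₂, h₂, hsum⟩ := Submodule.mem_sup.1 (Submodule.mem_comap.1 hY)
    obtain ⟨a, ha, rfl⟩ := mem_gateLie.1 h₁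
    obtain ⟨b, hb, rfl⟩ := mem_gateLie.1 h₂
    have hu {T : Finset (Fin n)} {c : Matrix (T → Fin 2) (T → Fin 2) ℂ} (hc : c ∈ skewAdjoint _) :
        NormedSpace.exp c ∈ unitary (Matrix (T → Fin 2) (T → Fin 2) ℂ) := by
      let _ : NormedAlgebra ℚ (Matrix (T → Fin 2) (T → Fin 2) ℂ) :=
        NormedAlgebra.restrictScalars ℚ ℝ _
      exact NormedSpace.exp_mem_unitary_of_mem_skewAdjoint hc
    refine ⟨_, ⟨v, hv, rfl⟩, _, hu ha, _, hu hb, ?_⟩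
    rw [map_mul, gateHom_exp, gateHom_exp, gateHom_exp,
      ← Matrix.exp_add_of_commute _ _ (gateHom_commute hAB a b), hsum]
    rfl

end GateHom

/-! ### Parameter count of a circuit with fixed supports. -/

section Circuits

open scoped Matrix.Norms.L2Operator

variable {n : ℕ}

/-- The operators implemented by circuits with gates on the given sets of qubits, up to a phase. -/
def circuitSet : {N : ℕ} → (Fin N → Finset (Fin n)) →
    Set (Matrix (Fin n → Fin 2) (Fin n → Fin 2) ℂ)
  | 0, _ => (fun z : ℂ => z • 1) '' Metric.sphere 0 1
  | N + 1, S => Set.image2 (· * ·) (gateHom (S (Fin.last N)) ''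
      (unitaryGroup (S (Fin.last N) → Fin 2) ℂ : Set (Matrix _ _ ℂ)))
      (circuitSet fun i : Fin N => S i.castSucc)

theorem isCompact_circuitSet {N : ℕ} (S : Fin N → Finset (Fin n)) :
    IsCompact (circuitSet S) := by
  induction N with
  | zero => exact (isCompact_sphere 0 1).image (by fun_prop)
  | succ N ih =>
    rw [circuitSet, ← Set.image_prod]
    refine IsCompact.image (IsCompact.prod (isCompact_unitaryGroup.image ?_) (ih _)) continuous_mul
    exact (gateHom _).toLinearMap.continuous_of_finiteDimensional

theorem smul_mem_circuitSet {N : ℕ} (S : Fin N → Finset (Fin n)) {z : ℂ} (hz : ‖z‖ = 1)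
    {X : Matrix (Fin n → Fin 2) (Fin n → Fin 2) ℂ} (hX : X ∈ circuitSet S) :
    z • X ∈ circuitSet S := by
  induction N generalizing X with
  | zero =>
    obtain ⟨w, hw, rfl⟩ := hX
    refine ⟨z * w, ?_, (smul_smul _ _ _).symm⟩
    simpa [hz] using hw
  | succ N ih =>
    obtain ⟨g, hg, Y, hY, rfl⟩ := hX
    exact ⟨g, hg, z • Y, ih _ hY, mul_smul_comm _ _ _⟩

theorem mem_circuitSet_of_implements {N : ℕ} {S : Fin N → Finset (Fin n)}
    {u : specialUnitaryGroup (Fin n → Fin 2) ℂ} (h : Implements S u) :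
    (u : Matrix (Fin n → Fin 2) (Fin n → Fin 2) ℂ) ∈ circuitSet S := by
  obtain ⟨U, hU⟩ := h
  rw [hU]
  clear hU
  induction N with
  | zero => exact ⟨1, by simp, by simp⟩
  | succ N ih =>
    rw [List.ofFn_succ', List.concat_eq_append, List.reverse_append, List.reverse_singleton,
      List.singleton_append, List.prod_cons]
    exact ⟨_, ⟨_, (U (Fin.last N)).2, rfl⟩, _, ih fun i => U i.castSucc, rfl⟩

/-- A unitary on no qubits is a phase, absorbed by the circle at the bottom of `circuitSet`. This
allows `∅` in place of a missing overlap. -/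
theorem gateHom_empty_mul_mem_circuitSet {N : ℕ} (S : Fin N → Finset (Fin n))
    {a : Matrix ((∅ : Finset (Fin n)) → Fin 2) ((∅ : Finset (Fin n)) → Fin 2) ℂ}
    (ha : a ∈ unitaryGroup _ ℂ) {X : Matrix (Fin n → Fin 2) (Fin n → Fin 2) ℂ}
    (hX : X ∈ circuitSet S) : gateHom ∅ a * X ∈ circuitSet S := by
  rw [gateHom_empty, smul_one_mul]
  refine smul_mem_circuitSet S ?_ hX
  have h := congrFun (congrFun ha.1 default) default
  rw [Matrix.mul_apply,
    Fintype.sum_eq_single default fun b hb => absurd (Subsingleton.elim b default) hb,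
    star_apply, one_apply_eq] at h
  have h' := congrArg norm h
  rw [norm_mul, norm_star, norm_one] at h'
  rcases mul_self_eq_one_iff.1 h' with h1 | h1
  · exact h1
  · linarith [norm_nonneg (a default default)]

/-- A gate on a set of qubits on which some gate acts, and none after it, is absorbed. -/
theorem gateHom_mul_mem_circuitSet {N : ℕ} (S : Fin N → Finset (Fin n)) {A : Finset (Fin n)}
    {j : Fin N} (hj : A ⊆ S j) (hl : ∀ l, j < l → Disjoint A (S l))
    {a : Matrix (A → Fin 2) (A → Fin 2) ℂ} (ha : a ∈ unitaryGroup _ ℂ)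
    {X : Matrix (Fin n → Fin 2) (Fin n → Fin 2) ℂ} (hX : X ∈ circuitSet S) :
    gateHom A a * X ∈ circuitSet S := by
  induction N generalizing X with
  | zero => exact j.elim0
  | succ N ih =>
    obtain ⟨_, ⟨g, hg, rfl⟩, Y, hY, rfl⟩ := hX
    induction j using Fin.lastCases with
    | last =>
      obtain ⟨b, hb, hba⟩ := exists_unitary_gateHom_eq_of_subset hj ha
      refine ⟨_, ⟨b * g, mul_mem hb hg, rfl⟩, Y, hY, ?_⟩
      rw [← hba, ← mul_assoc, map_mul]
    | cast j =>
      have hc := gateHom_commute (hl _ (Fin.castSucc_lt_last j)) a g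
      refine ⟨_, ⟨g, hg, rfl⟩, gateHom A a * Y,
        ih _ hj (fun l hjl => hl _ (Fin.castSucc_lt_castSucc_iff.2 hjl)) hY, ?_⟩
      dsimp only
      rw [← mul_assoc, ← mul_assoc, hc.eq]

/-- Induction by peeling off the last gate: its factors on `A` and `B` map the set of the shorter
circuit into itself, so only the coset parameters are added. With `A = B = ∅` a gate costs `4^|S| -
1`, its phase being passed down; the final `+ 1` is the global phase. -/
theorem isParam_circuitSet {N : ℕ} (S A B : Fin N → Finset (Fin n)) (hA : ∀ i, A i ⊆ S i)
    (hB : ∀ i, B i ⊆ S i) (hAB : ∀ i, Disjoint (A i) (B i))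
    (hA' : ∀ i, A i = ∅ ∨ Overlaps S i (A i)) (hB' : ∀ i, B i = ∅ ∨ Overlaps S i (B i)) :
    IsParam (∑ i, (4 ^ (S i).card + 1 - 4 ^ (A i).card - 4 ^ (B i).card) + 1) (circuitSet S) := by
  induction N with
  | zero =>
    refine ⟨{fun x => Complex.exp (x 0 * Complex.I) • 1}, Set.countable_singleton _, ?_, ?_⟩
    · rintro _ rfl
      have h : ContDiff ℝ 1 fun x : Fin (0 + 1) → ℝ => Complex.exp (x 0 * Complex.I) := by
        refine ContDiff.cexp (ContDiff.mul ?_ contDiff_const)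
        exact Complex.ofRealCLM.contDiff.comp (contDiff_apply ℝ ℝ 0)
      exact h.smul contDiff_const
    · rintro _ ⟨z, hz, rfl⟩
      have hz1 : ‖z‖ = 1 := by simpa using hz
      simp only [Set.mem_singleton_iff, Set.iUnion_iUnion_eq_left]
      refine ⟨fun _ => z.arg, ?_⟩
      have := Complex.norm_mul_exp_arg_mul_I z
      rw [hz1, Complex.ofReal_one, one_mul] at this
      simp only [this]
  | succ N ih =>
    have restrict (C : Fin (N + 1) → Finset (Fin n)) (hC : ∀ i, C i = ∅ ∨ Overlaps S i (C i))
        (i : Fin N) : C i.castSucc = ∅ ∨ Overlaps (fun i => S i.castSucc) i (C i.castSucc) := by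
      refine (hC i.castSucc).imp_right ?_
      rintro ⟨j, hj, hCj, hl⟩
      induction j using Fin.lastCases with
      | last => exact absurd hj (Fin.castSucc_lt_last i).not_gt
      | cast j =>
        exact ⟨j, Fin.castSucc_lt_castSucc_iff.1 hj, hCj, fun l hjl hli =>
          hl _ (Fin.castSucc_lt_castSucc_iff.2 hjl) (Fin.castSucc_lt_castSucc_iff.2 hli)⟩
    have absorb (C : Finset (Fin n)) (hC : C = ∅ ∨ Overlaps S (Fin.last N) C)
        {c : Matrix (C → Fin 2) (C → Fin 2) ℂ} (hc : c ∈ unitary _)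
        {X : Matrix (Fin n → Fin 2) (Fin n → Fin 2) ℂ}
        (hX : X ∈ circuitSet fun i : Fin N => S i.castSucc) :
        gateHom C c * X ∈ circuitSet fun i : Fin N => S i.castSucc := by
      rcases hC with rfl | ⟨j, hj, hCj, hl⟩
      · exact gateHom_empty_mul_mem_circuitSet _ hc hX
      · induction j using Fin.lastCases with
        | last => exact absurd hj (lt_irrefl _)
        | cast j =>
          exact gateHom_mul_mem_circuitSet (fun i : Fin N => S i.castSucc) hCj (fun l hjl =>
            hl _ (Fin.castSucc_lt_castSucc_iff.2 hjl) l.castSucc_lt_last) hc hX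
    have h := ih (fun i => S i.castSucc) (fun i => A i.castSucc) (fun i => B i.castSucc)
      (fun i => hA _) (fun i => hB _) (fun i => hAB _) (restrict A hA') (restrict B hB')
    obtain ⟨V, hV, hcov⟩ := exists_isParam_gate (hA (Fin.last N)) (hB (Fin.last N))
      (hAB (Fin.last N))
    refine ((hV.mul h).mono ?_).mono_dim ?_
    · rintro _ ⟨_, ⟨g, hg, rfl⟩, Y, hY, rfl⟩
      obtain ⟨v, hv, a, ha, b, hb, hvab⟩ := hcov g hg
      refine ⟨v, hv, _, absorb _ (hA' _) ha (absorb _ (hB' _) hb hY), ?_⟩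
      dsimp only
      rw [hvab, mul_assoc, mul_assoc]
    · rw [Fin.sum_univ_castSucc]
      omega

/-- A circuit with too few parameters misses a generic unitary. -/
theorem haar_circuit_eq_zero {N : ℕ} (S A B : Fin N → Finset (Fin n)) (hA : ∀ i, A i ⊆ S i)
    (hB : ∀ i, B i ⊆ S i) (hAB : ∀ i, Disjoint (A i) (B i))
    (hA' : ∀ i, A i = ∅ ∨ Overlaps S i (A i)) (hB' : ∀ i, B i = ∅ ∨ Overlaps S i (B i))
    (hp : ∑ i, (4 ^ (S i).card + 1 - 4 ^ (A i).card - 4 ^ (B i).card) + 1 < 4 ^ n)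
    (ν : Measure (specialUnitaryGroup (Fin n → Fin 2) ℂ)) [ν.IsHaarMeasure] :
    ν {u | (u : Matrix (Fin n → Fin 2) (Fin n → Fin 2) ℂ) ∈ circuitSet S} = 0 := by
  refine haar_eq_zero_of_isParam (isParam_circuitSet S A B hA hB hAB hA' hB') ?_
    (fun z hz x hx => smul_mem_circuitSet S hz hx) ν ?_ fun u hu => hu
  · rw [Fintype.card_fun, Fintype.card_fin, Fintype.card_fin, ← pow_mul, mul_comm n, pow_mul]
    exact hp
  · exact (isCompact_circuitSet S).isClosed.preimage continuous_subtype_val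

/-- A property that fails only on finitely many negligible families of circuits is generic. -/
theorem generic_of_circuits {ι : Type*} [Finite ι] (N : ι → ℕ)
    (S : ∀ i, Fin (N i) → Finset (Fin n))
    (hS : ∀ i, ∀ ν : Measure (specialUnitaryGroup (Fin n → Fin 2) ℂ), ν.IsHaarMeasure →
      ν {u | (u : Matrix (Fin n → Fin 2) (Fin n → Fin 2) ℂ) ∈ circuitSet (S i)} = 0)
    {P : specialUnitaryGroup (Fin n → Fin 2) ℂ → Prop}
    (hP : ∀ u, (∀ i, ¬ Implements (S i) u) → P u) : Generic n P := by
  have hnull (ν : Measure (specialUnitaryGroup (Fin n → Fin 2) ℂ)) (hν : ν.IsHaarMeasure) :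
      ν (⋃ i, {u | (u : Matrix (Fin n → Fin 2) (Fin n → Fin 2) ℂ) ∈ circuitSet (S i)}) = 0 :=
    measure_iUnion_null fun i => hS i ν hν
  refine ⟨(⋃ i, {u | (u : Matrix (Fin n → Fin 2) (Fin n → Fin 2) ℂ) ∈ circuitSet (S i)})ᶜ,
    ?_, ?_, ?_, ?_⟩
  · refine (isClosed_iUnion_of_finite fun i => ?_).isOpen_compl
    exact (isCompact_circuitSet (S i)).isClosed.preimage continuous_subtype_val
  -- Density comes from nullity: Haar measure is positive on nonempty open sets.
  · rw [← interior_eq_empty_iff_dense_compl]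
    exact Measure.interior_eq_empty_of_null
      (hnull (Measure.haar : Measure (specialUnitaryGroup (Fin n → Fin 2) ℂ)) inferInstance)
  · intro ν hν
    rw [compl_compl]
    exact hnull ν hν
  · intro u hu
    refine hP u fun i hi => hu (Set.mem_iUnion.2 ⟨i, mem_circuitSet_of_implements hi⟩)

end Circuits

/-! ### Dimensions of the group and of the coset spaces. -/

section Dimensions

variable {ι : Type*} [Fintype ι] [DecidableEq ι]

theorem su_le_skewAdjoint : su ι ≤ skewAdjoint.submodule ℝ (Matrix ι ι ℂ) := fun _ hX => hX.1

/-- Skew-adjoint matrices split as `su ⊕ ℝ i`, by subtracting the trace part. -/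
theorem finrank_su_add_one [Nonempty ι] :
    Module.finrank ℝ (su ι) + 1 = Fintype.card ι ^ 2 := by
  set s : Submodule ℝ (Matrix ι ι ℂ) := Submodule.span ℝ {Complex.I • (1 : Matrix ι ι ℂ)} with hs
  have hcard : (Fintype.card ι : ℂ) ≠ 0 := by simp
  have hne : Complex.I • (1 : Matrix ι ι ℂ) ≠ 0 := smul_ne_zero Complex.I_ne_zero one_ne_zero
  have hsup : su ι ⊔ s = skewAdjoint.submodule ℝ (Matrix ι ι ℂ) := by
    refine le_antisymm (sup_le su_le_skewAdjoint ?_) ?_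
    · rw [hs, Submodule.span_singleton_le_iff_mem]
      change star _ = _
      rw [star_smul, star_one]
      simp
    · intro X hX
      have hX' : star X = -X := hX
      have hre : X.trace.re = 0 := by
        have h : star X.trace = -X.trace := by
          rw [← trace_conjTranspose, ← star_eq_conjTranspose, hX', trace_neg]
        have := congrArg Complex.re h
        simp only [RCLike.star_def, Complex.conj_re, Complex.neg_re] at this
        linarith
      set c : ℝ := X.trace.im / Fintype.card ι
      have htr : (c : ℂ) * Complex.I * Fintype.card ι = X.trace := by
        have : X.trace = X.trace.im * Complex.I := by
          conv_lhs => rw [← Complex.re_add_im X.trace, hre]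
          simp
        conv_rhs => rw [this]
        simp only [c, Complex.ofReal_div, Complex.ofReal_natCast]
        field_simp
      refine Submodule.mem_sup.2 ⟨X - c • Complex.I • 1, ⟨?_, ?_⟩, c • Complex.I • 1,
        Submodule.smul_mem _ _ (Submodule.mem_span_singleton_self _), sub_add_cancel _ _⟩
      · rw [← star_eq_conjTranspose, star_sub, hX', star_smul, star_smul, star_one]
        simp [sub_eq_add_neg, add_comm]
      · rw [trace_sub, trace_smul, trace_smul, trace_one, ← htr, Complex.real_smul, smul_eq_mul,
          mul_assoc, sub_self]
  have hinf : su ι ⊓ s = ⊥ := by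
    refine eq_bot_iff.2 ?_
    rintro X ⟨⟨-, htr⟩, hX⟩
    obtain ⟨c, rfl⟩ := Submodule.mem_span_singleton.1 hX
    rw [trace_smul, trace_smul, trace_one, Complex.real_smul, smul_eq_mul] at htr
    have hc : c = 0 := by
      rcases mul_eq_zero.1 htr with h | h
      · exact_mod_cast h
      · exact absurd h (mul_ne_zero Complex.I_ne_zero hcard)
    simp [hc]
  have h := Submodule.finrank_sup_add_finrank_inf_eq (su ι) s
  rw [hsup, hinf, finrank_bot, finrank_skewAdjoint_matrix, hs, finrank_span_singleton hne] at h
  omega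

theorem dimSU_add_one {d : ℕ} (hd : 0 < d) : dimSU d + 1 = d ^ 2 := by
  have : Nonempty (Fin d) := ⟨⟨0, hd⟩⟩
  rw [dimSU, finrank_su_add_one, Fintype.card_fin]

/-- The inclusion of the operators on the left factor. -/
def kroneckerOne (a b : ℕ) :
    Matrix (Fin a) (Fin a) ℂ →ₗ[ℝ] Matrix (Fin a × Fin b) (Fin a × Fin b) ℂ where
  toFun X := X ⊗ₖ 1
  map_add' X Y := add_kronecker X Y 1
  map_smul' c X := smul_kronecker c X 1

/-- The inclusion of the operators on the right factor. -/
def oneKronecker (a b : ℕ) :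
    Matrix (Fin b) (Fin b) ℂ →ₗ[ℝ] Matrix (Fin a × Fin b) (Fin a × Fin b) ℂ where
  toFun X := 1 ⊗ₖ X
  map_add' X Y := kronecker_add 1 X Y
  map_smul' c X := kronecker_smul c 1 X

theorem suLeft_eq_map (a b : ℕ) : suLeft a b = (su (Fin a)).map (kroneckerOne a b) := by
  have : {Y | ∃ X ∈ su (Fin a), Y = X ⊗ₖ (1 : Matrix (Fin b) (Fin b) ℂ)} =
      ((su (Fin a)).map (kroneckerOne a b) : Set _) := by
    ext Y
    exact ⟨fun ⟨X, hX, h⟩ => ⟨X, hX, h.symm⟩, fun ⟨X, hX, h⟩ => ⟨X, hX, h.symm⟩⟩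
  rw [suLeft, this, Submodule.span_eq]

theorem suRight_eq_map (a b : ℕ) : suRight a b = (su (Fin b)).map (oneKronecker a b) := by
  have : {Y | ∃ X ∈ su (Fin b), Y = (1 : Matrix (Fin a) (Fin a) ℂ) ⊗ₖ X} =
      ((su (Fin b)).map (oneKronecker a b) : Set _) := by
    ext Y
    exact ⟨fun ⟨X, hX, h⟩ => ⟨X, hX, h.symm⟩, fun ⟨X, hX, h⟩ => ⟨X, hX, h.symm⟩⟩
  rw [suRight, this, Submodule.span_eq]

variable {a b : ℕ}

theorem kroneckerOne_injective (hb : 0 < b) : Function.Injective (kroneckerOne a b) := by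
  intro X Y h
  ext i j
  simpa [kroneckerOne] using congrFun (congrFun h (i, ⟨0, hb⟩)) (j, ⟨0, hb⟩)

theorem oneKronecker_injective (ha : 0 < a) : Function.Injective (oneKronecker a b) := by
  intro X Y h
  ext i j
  simpa [oneKronecker] using congrFun (congrFun h (⟨0, ha⟩, i)) (⟨0, ha⟩, j)

theorem suLeft_le_su (a b : ℕ) : suLeft a b ≤ su (Fin a × Fin b) := by
  rw [suLeft_eq_map]
  rintro _ ⟨X, ⟨h1, h2⟩, rfl⟩
  refine ⟨?_, ?_⟩
  · change (X ⊗ₖ (1 : Matrix (Fin b) (Fin b) ℂ))ᴴ = -kroneckerOne a b X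
    rw [← map_neg, conjTranspose_kronecker, h1, conjTranspose_one]
    rfl
  · change (X ⊗ₖ (1 : Matrix (Fin b) (Fin b) ℂ)).trace = 0
    rw [trace_kronecker, h2, zero_mul]

theorem suRight_le_su (a b : ℕ) : suRight a b ≤ su (Fin a × Fin b) := by
  rw [suRight_eq_map]
  rintro _ ⟨X, ⟨h1, h2⟩, rfl⟩
  refine ⟨?_, ?_⟩
  · change ((1 : Matrix (Fin a) (Fin a) ℂ) ⊗ₖ X)ᴴ = -oneKronecker a b X
    rw [← map_neg, conjTranspose_kronecker, h1, conjTranspose_one]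
    rfl
  · change ((1 : Matrix (Fin a) (Fin a) ℂ) ⊗ₖ X).trace = 0
    rw [trace_kronecker, h2, mul_zero]

/-- `X ⊗ 1 = 1 ⊗ Y` makes `X` scalar, and a traceless scalar matrix vanishes. -/
theorem suLeft_inf_suRight (ha : 0 < a) (hb : 0 < b) : suLeft a b ⊓ suRight a b = ⊥ := by
  refine eq_bot_iff.2 ?_
  rw [suLeft_eq_map, suRight_eq_map]
  rintro _ ⟨⟨X, ⟨-, hX⟩, rfl⟩, ⟨Y, -, hY⟩⟩
  have hent (i j : Fin a) : X i j = if i = j then Y ⟨0, hb⟩ ⟨0, hb⟩ else 0 := by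
    have := congrFun (congrFun hY (i, ⟨0, hb⟩)) (j, ⟨0, hb⟩)
    simpa [kroneckerOne, oneKronecker, Matrix.one_apply, eq_comm] using this
  have hX0 : X = 0 := by
    have h0 : Y ⟨0, hb⟩ ⟨0, hb⟩ = 0 := by
      have : X.trace = a * Y ⟨0, hb⟩ ⟨0, hb⟩ := by simp [trace, hent]
      rw [this] at hX
      exact (mul_eq_zero.1 hX).resolve_left (by exact_mod_cast ha.ne')
    ext i j
    simp [hent, h0]
  simp [hX0]

theorem finrank_suLeft_add_one (ha : 0 < a) (hb : 0 < b) :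
    Module.finrank ℝ (suLeft a b) + 1 = a ^ 2 := by
  rw [suLeft_eq_map, ← (Submodule.equivMapOfInjective _ (kroneckerOne_injective hb) _).finrank_eq]
  exact dimSU_add_one ha

theorem finrank_suRight_add_one (ha : 0 < a) (hb : 0 < b) :
    Module.finrank ℝ (suRight a b) + 1 = b ^ 2 := by
  rw [suRight_eq_map, ← (Submodule.equivMapOfInjective _ (oneKronecker_injective ha) _).finrank_eq]
  exact dimSU_add_one hb

theorem finrank_su_prod_add_one (ha : 0 < a) (hb : 0 < b) :
    Module.finrank ℝ (su (Fin a × Fin b)) + 1 = (a * b) ^ 2 := by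
  have : Nonempty (Fin a × Fin b) := ⟨(⟨0, ha⟩, ⟨0, hb⟩)⟩
  rw [finrank_su_add_one, Fintype.card_prod, Fintype.card_fin, Fintype.card_fin]

theorem dimCosetLeft_add (ha : 0 < a) (hb : 0 < b) : dimCosetLeft a b + a ^ 2 = (a * b) ^ 2 := by
  have h := Submodule.finrank_quotient_add_finrank ((suLeft a b).submoduleOf (su (Fin a × Fin b)))
  rw [(Submodule.submoduleOfEquivOfLe (suLeft_le_su a b)).finrank_eq] at h
  have h1 := finrank_suLeft_add_one ha hb
  have h2 := finrank_su_prod_add_one ha hb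
  rw [dimCosetLeft]
  omega

theorem dimCosetBoth_add (ha : 0 < a) (hb : 0 < b) :
    dimCosetBoth a b + a ^ 2 + b ^ 2 = (a * b) ^ 2 + 1 := by
  have h := Submodule.finrank_quotient_add_finrank
    ((suLeft a b ⊔ suRight a b).submoduleOf (su (Fin a × Fin b)))
  rw [(Submodule.submoduleOfEquivOfLe (sup_le (suLeft_le_su a b) (suRight_le_su a b))).finrank_eq]
    at h
  have h0 := Submodule.finrank_sup_add_finrank_inf_eq (suLeft a b) (suRight a b)
  rw [suLeft_inf_suRight ha hb, finrank_bot] at h0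
  have h1 := finrank_suLeft_add_one ha hb
  have h2 := finrank_su_prod_add_one ha hb
  have h3 := finrank_suRight_add_one ha hb
  rw [dimCosetBoth]
  omega

theorem two_pow_sq (k : ℕ) : (2 ^ k) ^ 2 = 4 ^ k := by
  rw [← pow_mul, mul_comm, pow_mul]
  norm_num

theorem dimSU_two_pow (m : ℕ) : dimSU (2 ^ m) = 4 ^ m - 1 := by
  have := dimSU_add_one (d := 2 ^ m) (by positivity)
  rw [two_pow_sq] at this
  omega

theorem dimCosetLeft_two_pow (m μ : ℕ) :
    dimCosetLeft (2 ^ (m - μ)) (2 ^ μ) = 4 ^ (m - μ) * (4 ^ μ - 1) := by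
  have := dimCosetLeft_add (a := 2 ^ (m - μ)) (b := 2 ^ μ) (by positivity) (by positivity)
  rw [mul_pow, two_pow_sq, two_pow_sq] at this
  rw [Nat.mul_sub, mul_one]
  omega

theorem dimCosetBoth_two_pow (m μ : ℕ) :
    dimCosetBoth (2 ^ (m - μ)) (2 ^ μ) = (4 ^ (m - μ) - 1) * (4 ^ μ - 1) := by
  have := dimCosetBoth_add (a := 2 ^ (m - μ)) (b := 2 ^ μ) (by positivity) (by positivity)
  rw [mul_pow, two_pow_sq, two_pow_sq] at this
  have h1 : 1 ≤ 4 ^ (m - μ) := Nat.one_le_pow _ _ (by norm_num)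
  have h2 : 1 ≤ 4 ^ μ := Nat.one_le_pow _ _ (by norm_num)
  zify [h1, h2] at this ⊢
  linarith

end Dimensions

/-! ### Arithmetic of the closed formulas. -/

section Formulas

/-- Both sides are `≤ z` exactly when `x / c + q ≤ z * q`; the inner ceiling is harmless because `z
* q` is an integer. -/
theorem one_add_ceil_eq (x c : ℚ) {q : ℕ} (hq : 0 < q) :
    1 + ⌈x / (q * c)⌉ = ⌈((⌈x / c + (q : ℚ)⌉ : ℤ) : ℚ) / (q : ℚ)⌉ := by
  have hq' : (0 : ℚ) < q := by exact_mod_cast hq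
  refine eq_of_forall_ge_iff fun z => ?_
  rw [Int.ceil_le, div_le_iff₀ hq']
  have h1 : ((⌈x / c + (q : ℚ)⌉ : ℤ) : ℚ) ≤ z * q ↔ ⌈x / c + (q : ℚ)⌉ ≤ z * q := by
    rw [← Int.cast_le (R := ℚ)]
    push_cast
    rfl
  rw [h1, Int.ceil_le, ← le_sub_iff_add_le', Int.ceil_le, mul_comm (q : ℚ) c, ← div_div,
    div_le_iff₀ hq']
  push_cast
  constructor <;> intro h <;> linarith

theorem ceil_div_add_mono {x y c : ℚ} (hc : 0 < c) (h : x ≤ y) (q : ℚ) :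
    ⌈x / c + q⌉ ≤ ⌈y / c + q⌉ := by
  gcongr

/-- The number of parameters of a gate that overlaps with two adjacent previous gates. -/
def overlapParams (m μ : ℕ) : ℚ := 4 ^ m - 4 ^ μ - 4 ^ (m - μ) + 1

variable {n m μ k : ℕ}

theorem overlapParams_eq (h : μ ≤ m) : overlapParams m μ = (4 ^ (m - μ) - 1) * (4 ^ μ - 1) := by
  rw [overlapParams]
  nth_rewrite 1 [← Nat.sub_add_cancel h]
  rw [pow_add]
  ring

theorem four_le_four_pow (h : 0 < μ) : (4 : ℚ) ≤ 4 ^ μ := by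
  calc (4 : ℚ) = 4 ^ 1 := by norm_num
    _ ≤ 4 ^ μ := pow_le_pow_right₀ (by norm_num) h

theorem overlapParams_pos (h0 : 0 < μ) (h : μ < m) : 0 < overlapParams m μ := by
  rw [overlapParams_eq h.le]
  have h1 := four_le_four_pow h0
  have h2 := four_le_four_pow (Nat.sub_pos_of_lt h)
  exact mul_pos (by linarith) (by linarith)

theorem slotExact_eq (hq : 0 < n / m) (k : ℕ) :
    slotExact n m μ k = ⌈(gateExact n m μ k : ℚ) / ((n / m : ℕ) : ℚ)⌉ :=
  one_add_ceil_eq _ _ hq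

theorem slotA_eq (hq : 0 < n / m) : slotA n m μ = ⌈(gateA n m μ : ℚ) / ((n / m : ℕ) : ℚ)⌉ :=
  one_add_ceil_eq _ _ hq

theorem slotB_eq (hq : 0 < n / m) : slotB n m μ = ⌈(gateB n m μ : ℚ) / ((n / m : ℕ) : ℚ)⌉ :=
  one_add_ceil_eq _ _ hq

theorem slotC_eq (hq : 0 < n / m) : slotC n m μ = ⌈(gateC n m μ : ℚ) / ((n / m : ℕ) : ℚ)⌉ :=
  one_add_ceil_eq _ _ hq

theorem gateExact_zero : gateExact n m μ 0 = gateA n m μ := by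
  simp [gateExact, gateA]

theorem slotExact_zero : slotExact n m μ 0 = slotA n m μ := by
  simp [slotExact, slotA]

theorem gateC_le_gateB (h0 : 0 < μ) (h : μ < m) : gateC n m μ ≤ gateB n m μ := by
  have := four_le_four_pow (Nat.sub_pos_of_lt h)
  exact ceil_div_add_mono (overlapParams_pos h0 h) (by linarith) _

theorem gateB_le_gateA (h0 : 0 < μ) (h : μ < m) : gateB n m μ ≤ gateA n m μ := by
  have := four_le_four_pow (Nat.sub_pos_of_lt h)
  exact ceil_div_add_mono (overlapParams_pos h0 h) (by linarith) _

/-- Per overhead, the closed formulas deduct `4^(m-μ) - 1`, the exact count only `4^μ - 1`. The two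
agree for `m = 2μ`. -/
theorem gateB_le_gateExact (h0 : 0 < μ) (h : 2 * μ ≤ m) : gateB n m μ ≤ gateExact n m μ 1 := by
  have : (4 : ℚ) ^ μ ≤ 4 ^ (m - μ) := pow_le_pow_right₀ (by norm_num) (by omega)
  refine ceil_div_add_mono (overlapParams_pos h0 (by omega)) ?_ _
  push_cast
  linarith

theorem gateC_le_gateExact (h0 : 0 < μ) (h : 2 * μ ≤ m) : gateC n m μ ≤ gateExact n m μ 2 := by
  have : (4 : ℚ) ^ μ ≤ 4 ^ (m - μ) := pow_le_pow_right₀ (by norm_num) (by omega)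
  refine ceil_div_add_mono (overlapParams_pos h0 (by omega)) ?_ _
  push_cast
  linarith

theorem gateExact_one_of_eq (h : m = 2 * μ) : gateExact n m μ 1 = gateB n m μ := by
  have h' : m - μ = μ := by omega
  rw [gateExact, gateB, h']
  congr 3
  push_cast
  ring

theorem gateExact_two_of_eq (h : m = 2 * μ) : gateExact n m μ 2 = gateC n m μ := by
  have h' : m - μ = μ := by omega
  rw [gateExact, gateC, h']
  congr 3
  push_cast
  ring

theorem gateExact_le_iff (h0 : 0 < μ) (h : μ < m) (z : ℤ) :
    gateExact n m μ k ≤ z ↔ (4 : ℚ) ^ n - 1 - k * (4 ^ μ - 1) - (n / m : ℕ) * (4 ^ m - 1) ≤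
      (z - (n / m : ℕ)) * overlapParams m μ := by
  rw [gateExact, Int.ceil_le, ← le_sub_iff_add_le, ← overlapParams,
    div_le_iff₀ (overlapParams_pos h0 h)]

/-- A crude bound suffices: with `r = n / m + k` one has `n ≥ m + (r - 1)` and `r ≤ 4^(r-1)`. -/
theorem add_mul_four_pow_le (h0 : 0 < μ) (h : μ < m) (hq : 0 < n / m) (hk : n % m = k * μ) :
    (n / m + k) * 4 ^ m ≤ 4 ^ n := by
  have hn := Nat.div_add_mod n m
  set q := n / m
  have h1 : q - 1 + k + m ≤ n := by
    rw [hk] at hn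
    obtain ⟨p, hp⟩ : ∃ p, q = p + 1 := ⟨q - 1, by omega⟩
    rw [hp] at hn ⊢
    have h2 : p ≤ m * p := Nat.le_mul_of_pos_left _ (by omega)
    have h3 : k ≤ k * μ := Nat.le_mul_of_pos_right _ h0
    rw [mul_add] at hn
    omega
  have h2 : q + k ≤ 4 ^ (q - 1 + k) := by
    have := Nat.lt_pow_self (n := q - 1 + k) (a := 4) (by norm_num)
    omega
  calc (q + k) * 4 ^ m ≤ 4 ^ (q - 1 + k) * 4 ^ m := Nat.mul_le_mul_right _ h2
    _ = 4 ^ (q - 1 + k + m) := (pow_add _ _ _).symm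
    _ ≤ 4 ^ n := Nat.pow_le_pow_right (by norm_num) h1

theorem add_mul_four_pow_le_cast (h0 : 0 < μ) (h : μ < m) (hq : 0 < n / m)
    (hk : n % m = k * μ) : (((n / m : ℕ) : ℚ) + k) * 4 ^ m ≤ 4 ^ n := by
  exact_mod_cast add_mul_four_pow_le h0 h hq hk

/-- Places the minimum in the range where the subtraction in `paramCount` is not truncated. -/
theorem add_le_gateExact (h0 : 0 < μ) (h : μ < m) (hq : 0 < n / m) (hk : n % m = k * μ) :
    ((n / m + k : ℕ) : ℤ) ≤ gateExact n m μ k := by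
  rw [← Int.sub_one_lt_iff, ← not_le, gateExact_le_iff h0 h, not_le]
  have h1 := add_mul_four_pow_le_cast h0 h hq hk
  have h2 : (1 : ℚ) ≤ (n / m : ℕ) := by exact_mod_cast hq
  have h3 := four_le_four_pow (Nat.sub_pos_of_lt h)
  have h4 : (0 : ℚ) ≤ k := Nat.cast_nonneg _
  have h5 := overlapParams_pos h0 h
  have h6 : (k : ℚ) * 4 ^ (m - μ) ≥ 0 := by positivity
  rw [Int.cast_sub, Int.cast_natCast, Nat.cast_add, Int.cast_one]
  have : ((n / m : ℕ) + (k : ℚ) - 1 - (n / m : ℕ)) * overlapParams m μ =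
      k * (4 ^ m - 4 ^ μ - 4 ^ (m - μ) + 1) - overlapParams m μ := by
    rw [overlapParams]; ring
  rw [this]
  linarith

/-- A gate with overhead brings `4^μ - 1` parameters more than one with two overlaps. -/
theorem paramCount_cast (h : μ ≤ m) {N : ℕ} (hN : n / m + k ≤ N) :
    (paramCount n m μ k N : ℚ) = (n / m : ℕ) * (4 ^ m - 1) + k * (4 ^ μ - 1) +
      (N - (n / m : ℕ)) * overlapParams m μ := by
  have h1 (j : ℕ) : 1 ≤ 4 ^ j := Nat.one_le_pow _ _ (by norm_num)
  rw [paramCount, dimSU_two_pow, dimCosetLeft_two_pow, dimCosetBoth_two_pow,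
    overlapParams_eq h, Nat.sub_sub]
  push_cast [h1, hN]
  ring

theorem dimSU_le_paramCount_iff (h0 : 0 < μ) (h : μ < m) {N : ℕ} (hN : n / m + k ≤ N) :
    dimSU (2 ^ n) ≤ paramCount n m μ k N ↔ gateExact n m μ k ≤ N := by
  rw [gateExact_le_iff h0 h, ← Nat.cast_le (α := ℚ), paramCount_cast h.le hN, dimSU_two_pow,
    Nat.cast_sub (Nat.one_le_pow _ _ (by norm_num))]
  push_cast
  constructor <;> intro h <;> linarith

theorem exists_isLeast_gateExact (h0 : 0 < μ) (h : μ < m) (hq : 0 < n / m)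
    (hk : n % m = k * μ) :
    ∃ g : ℕ, (g : ℤ) = gateExact n m μ k ∧
      IsLeast {N : ℕ | n / m + k ≤ N ∧ dimSU (2 ^ n) ≤ paramCount n m μ k N} g := by
  have hle := add_le_gateExact h0 h hq hk
  obtain ⟨g, hg⟩ := Int.eq_ofNat_of_zero_le (le_trans (Int.natCast_nonneg _) hle)
  have hg' : n / m + k ≤ g := by
    rw [hg] at hle
    exact_mod_cast hle
  refine ⟨g, hg.symm, ⟨hg', ?_⟩, ?_⟩
  · exact (dimSU_le_paramCount_iff h0 h hg').2 hg.le
  · rintro N ⟨hN, hN'⟩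
    have := (dimSU_le_paramCount_iff h0 h hN).1 hN'
    rw [hg] at this
    exact_mod_cast this

theorem div_le_div_of_le_of_le {x y c d : ℚ} (hx : 0 ≤ x) (hyx : y ≤ x) (hc : 0 < c)
    (hcd : c ≤ d) : y / d ≤ x / c :=
  calc y / d ≤ x / d := by have := hc.trans_le hcd; gcongr
    _ ≤ x / c := div_le_div_of_nonneg_left hx hc hcd

/-- With `b = a + i` and `s - a = b + j`, the difference is `4^a (4^i - 1)(4^j - 1)`. -/
theorem four_pow_add_four_pow_le {a b s : ℕ} (h : a ≤ b) (hb : b ≤ s - a) (ha : a ≤ s) :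
    (4 : ℚ) ^ b + 4 ^ (s - b) ≤ 4 ^ a + 4 ^ (s - a) := by
  obtain ⟨i, rfl⟩ := Nat.exists_eq_add_of_le h
  obtain ⟨j, hj⟩ := Nat.exists_eq_add_of_le hb
  have h1 : s - (a + i) = a + j := by omega
  rw [h1, hj, pow_add, pow_add, pow_add, pow_add]
  have h2 : (1 : ℚ) ≤ 4 ^ i := one_le_pow₀ (by norm_num)
  have h3 : (1 : ℚ) ≤ 4 ^ j := one_le_pow₀ (by norm_num)
  have h4 : (0 : ℚ) < 4 ^ a := by positivity
  nlinarith [mul_nonneg h4.le (mul_nonneg (sub_nonneg.2 h2) (sub_nonneg.2 h3))]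

/-- Balanced overlaps provide the most parameters per gate. -/
theorem overlapParams_le_half {ν : ℕ} (h : ν ≤ m) :
    overlapParams m ν ≤ overlapParams m (m / 2) := by
  have key : (4 : ℚ) ^ (m / 2) + 4 ^ (m - m / 2) ≤ 4 ^ ν + 4 ^ (m - ν) := by
    rcases le_total ν (m / 2) with h1 | h1
    · exact four_pow_add_four_pow_le h1 (by omega) h
    · have h2 : m - (m - ν) = ν := by omega
      rcases Nat.lt_or_ge (m - ν) (m / 2 + 1) with h3 | h3
      · have := four_pow_add_four_pow_le (a := m - ν) (b := m / 2) (s := m) (by omega) (by omega)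
          (by omega)
        rw [h2] at this
        linarith
      · have h3 : ν = m / 2 := by omega
        rw [h3]
  rw [overlapParams, overlapParams]
  linarith

/-- The balanced overlap has the larger denominator. If `k = 0` or `ν ≤ m - m / 2`, its numerator is
also the smaller one. Otherwise `2 * ν > m` excludes `k = 2`; for `k = 1` the numerators may compare
the wrong way, and the gain in the denominator has to outweigh this. -/
theorem gateC_half_le_gateExact {ν : ℕ} (h0 : 0 < ν) (h : ν < m) (hq : 0 < n / m)
    (hk : n % m = k * ν) (hk2 : k ≤ 2) : gateC n m (m / 2) ≤ gateExact n m ν k := by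
  have hpos := overlapParams_pos h0 h
  have hle := overlapParams_le_half h.le
  have hL := add_mul_four_pow_le_cast h0 h hq hk
  have hq1 : (1 : ℚ) ≤ (n / m : ℕ) := by exact_mod_cast hq
  have hν : (4 : ℚ) ^ ν ≤ 4 ^ m := pow_le_pow_right₀ (by norm_num) h.le
  have hk0 : (0 : ℚ) ≤ k := Nat.cast_nonneg _
  set L : ℚ := (4 : ℚ) ^ n - (n / m : ℕ) * (4 ^ m - 1) with hLdef
  have hmain : (L + 1 - 2 * 4 ^ (m - m / 2)) / overlapParams m (m / 2) ≤
      (L - 1 - k * (4 ^ ν - 1)) / overlapParams m ν := by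
    by_cases hcase : k = 0 ∨ ν ≤ m - m / 2
    · refine div_le_div_of_le_of_le ?_ ?_ hpos hle
      · have := mul_le_mul_of_nonneg_left hν hk0
        linarith
      · rcases hcase with rfl | hcase
        · have : (1 : ℚ) ≤ 4 ^ (m - m / 2) := one_le_pow₀ (by norm_num)
          push_cast
          linarith
        · have h1 : (4 : ℚ) ^ ν ≤ 4 ^ (m - m / 2) := pow_le_pow_right₀ (by norm_num) hcase
          have h2 : (1 : ℚ) ≤ 4 ^ ν := one_le_pow₀ (by norm_num)
          have h3 : (k : ℚ) ≤ 2 := by exact_mod_cast hk2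
          nlinarith
    · push Not at hcase
      obtain ⟨hk', hνm⟩ := hcase
      have hk1 : k = 1 := by
        have := Nat.mod_lt n (show 0 < m by omega)
        rw [hk] at this
        by_contra hne
        have hk3 : k = 2 := by omega
        subst hk3
        omega
      subst hk1
      -- Reading the remainder as `ν` single qubits gives the stronger bound `L ≥ ν * 4^m`.
      have hL' := add_mul_four_pow_le_cast (k := ν) one_pos (by omega) hq (by omega : n % m = ν * 1)
      have hν2 : (2 : ℚ) ≤ ν := by exact_mod_cast (by omega : 2 ≤ ν)
      have hM : (0 : ℚ) < 4 ^ m := by positivity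
      have hLM : 2 * (4 : ℚ) ^ m ≤ L := by nlinarith
      have hH1 : (1 : ℚ) ≤ 4 ^ (m - m / 2) := one_le_pow₀ (by norm_num)
      have hH2 : (4 : ℚ) ^ (m / 2) ≤ 4 ^ (m - m / 2) := pow_le_pow_right₀ (by norm_num) (by omega)
      have hx : 4 * (4 : ℚ) ^ (m - m / 2) ≤ 4 ^ ν := by
        rw [← pow_succ']
        exact pow_le_pow_right₀ (by norm_num) hνm
      have hy : (0 : ℚ) < 4 ^ (m - ν) := by positivity
      have hs : (1 : ℚ) ≤ 4 ^ (m / 2) := one_le_pow₀ (by norm_num)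
      have hc : overlapParams m (m / 2) ≤ 4 ^ m := by rw [overlapParams]; linarith
      -- Both powers in the balanced count are at most `4^ν / 4`.
      have hdiff : (4 : ℚ) ^ ν / 2 ≤ overlapParams m (m / 2) - overlapParams m ν := by
        rw [overlapParams, overlapParams]; linarith
      rw [div_le_div_iff₀ (hpos.trans_le hle) hpos]
      have h1 : (4 : ℚ) ^ ν * overlapParams m (m / 2) ≤ 4 ^ ν * 4 ^ m :=
        mul_le_mul_of_nonneg_left hc (by positivity)
      have h2 : 2 * (4 : ℚ) ^ m * (4 ^ ν / 2) ≤
          L * (overlapParams m (m / 2) - overlapParams m ν) :=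
        mul_le_mul hLM hdiff (by positivity) (by linarith)
      have h3 : 0 ≤ (2 * (4 : ℚ) ^ (m - m / 2) - 1) * overlapParams m ν :=
        mul_nonneg (by linarith) hpos.le
      push_cast
      linarith
  have e1 : (L + 1 - 2 * 4 ^ (m - m / 2)) = (4 : ℚ) ^ n + 1 - 2 * 4 ^ (m - m / 2) -
      ((n / m : ℕ) : ℚ) * (4 ^ m - 1) := by rw [hLdef]; ring
  have e2 : (L - 1 - k * (4 ^ ν - 1)) = (4 : ℚ) ^ n - 1 - k * (4 ^ ν - 1) -
      ((n / m : ℕ) : ℚ) * (4 ^ m - 1) := by rw [hLdef]; ring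
  rw [e1, e2] at hmain
  refine Int.ceil_le_ceil ?_
  rw [overlapParams, overlapParams] at hmain
  linarith

end Formulas

/-! ### Counting gates, overheads and time slots in networks. -/

section Networks

variable {n m μ k N T : ℕ}

/-- Circuits of this shape implement a set of unitaries of Haar measure zero only. -/
def Negligible (S : Fin N → Finset (Fin n)) : Prop :=
  ∀ ν : Measure (specialUnitaryGroup (Fin n → Fin 2) ℂ), ν.IsHaarMeasure →
    ν {u | (u : Matrix (Fin n → Fin 2) (Fin n → Fin 2) ℂ) ∈ circuitSet S} = 0

theorem Generic.mono {P Q : specialUnitaryGroup (Fin n → Fin 2) ℂ → Prop} (h : Generic n P)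
    (hPQ : ∀ u, P u → Q u) : Generic n Q := by
  obtain ⟨O, h1, h2, h3, h4⟩ := h
  exact ⟨O, h1, h2, h3, fun u hu => hPQ u (h4 u hu)⟩

/-- There are finitely many support patterns with fewer than `b` gates, so one generic set serves
them all. -/
theorem generic_not_implements (n b : ℕ) : Generic n fun u =>
    ∀ N < b, ∀ S : Fin N → Finset (Fin n), Negligible S → ¬ Implements S u :=
  generic_of_circuits (ι := Σ N : Fin b, {S : Fin N → Finset (Fin n) // Negligible S})
    (fun i => i.1) (fun i => i.2.1) (fun i => i.2.2)
    fun _ hu N hN S hS => hu ⟨⟨N, hN⟩, ⟨S, hS⟩⟩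

theorem sum_card_le_of_disjoint {G : Fin N → Finset (Fin n)}
    (hG : ∀ i j, i < j → Disjoint (G i) (G j)) : ∑ i, (G i).card ≤ n := by
  rw [← Finset.card_biUnion]
  · exact (Finset.card_le_univ _).trans (by simp)
  · intro i _ j _ hij
    rcases lt_or_gt_of_ne hij with h | h
    · exact hG i j h
    · exact (hG j i h).symm

/-- Amounts to `(4^a - 1)(4^b - 1) ≥ 0`; it ensures that the cost of a gate is not truncated. -/
theorem four_pow_add_four_pow_le_succ {a b s : ℕ} (h : a + b ≤ s) :
    4 ^ a + 4 ^ b ≤ 4 ^ s + 1 := by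
  have h1 : 1 ≤ 4 ^ a := Nat.one_le_pow _ _ (by norm_num)
  have h2 : 1 ≤ 4 ^ b := Nat.one_le_pow _ _ (by norm_num)
  have h3 : 4 ^ (a + b) ≤ 4 ^ s := Nat.pow_le_pow_right (by norm_num) h
  rw [pow_add] at h3
  obtain ⟨x, hx⟩ := Nat.exists_eq_add_of_le h1
  obtain ⟨y, hy⟩ := Nat.exists_eq_add_of_le h2
  rw [hx, hy] at h3 ⊢
  have : (1 + x) * (1 + y) = 1 + x + y + x * y := by ring
  have := Nat.zero_le (x * y)
  omega

namespace ModuleNetwork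

/-- Uniform data for all gates: `A` and `B` are divided out, `F` is the overhead. In the first slot
all three are empty. -/
theorem exists_overlaps (W : ModuleNetwork n m μ N T) (i : Fin N) :
    ∃ A B F : Finset (Fin n), A ⊆ W.support i ∧ B ⊆ W.support i ∧ F ⊆ W.support i ∧
      Disjoint A B ∧ (A = ∅ ∨ Overlaps W.support i A) ∧ (B = ∅ ∨ Overlaps W.support i B) ∧
      Fresh W.support i F ∧ ((W.slot i : ℕ) = 0 → A = ∅ ∧ B = ∅ ∧ F = ∅) ∧
      ((W.slot i : ℕ) ≠ 0 → B.card = m - μ ∧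
        (A.card = μ ∧ F = ∅ ∨ A = ∅ ∧ F.card = μ)) := by
  by_cases h : (W.slot i : ℕ) = 0
  · exact ⟨∅, ∅, ∅, by simp, by simp, by simp, by simp, by simp, by simp, fun _ _ => by simp,
      by simp, fun h' => absurd h h'⟩
  · obtain ⟨A, B, hAB, hu, hA, hB, hBo, hAo⟩ := W.later_slots i h
    have hAs : A ⊆ W.support i := hu ▸ Finset.subset_union_left
    have hBs : B ⊆ W.support i := hu ▸ Finset.subset_union_right
    rcases hAo with hAo | hAf
    · exact ⟨A, B, ∅, hAs, hBs, by simp, hAB, Or.inr hAo, Or.inr hBo, fun _ _ => by simp,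
        fun h' => absurd h' h, fun _ => ⟨hB, Or.inl ⟨hA, rfl⟩⟩⟩
    · exact ⟨∅, B, A, by simp, hBs, hAs, by simp, Or.inl rfl, Or.inr hBo, hAf,
        fun h' => absurd h' h, fun _ => ⟨hB, Or.inr ⟨rfl, hA⟩⟩⟩

theorem card_slot_le (W : ModuleNetwork n m μ N T) (hm : 0 < m) (t : Fin T) :
    (Finset.univ.filter fun i => W.slot i = t).card ≤ n / m := by
  rw [Nat.le_div_iff_mul_le hm]
  calc (Finset.univ.filter fun i => W.slot i = t).card * m
      = ∑ i, (if W.slot i = t then W.support i else ∅).card := by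
        simp only [apply_ite Finset.card, W.card_support, Finset.card_empty]
        rw [← Finset.sum_filter, Finset.sum_const, smul_eq_mul]
    _ ≤ n := sum_card_le_of_disjoint fun i j hij => by
        split_ifs with h1 h2
        · exact W.parallel i j hij.ne (h1.trans h2.symm)
        all_goals simp

theorem le_div_mul (W : ModuleNetwork n m μ N T) (hm : 0 < m) : N ≤ n / m * T := by
  have h := Finset.card_eq_sum_card_fiberwise (f := W.slot) (s := Finset.univ)
    (t := Finset.univ) (by simp)
  rw [Finset.card_univ, Fintype.card_fin] at h
  rw [h]
  refine (Finset.sum_le_card_nsmul _ _ (n / m) fun t _ => W.card_slot_le hm t).trans ?_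
  simp [mul_comm]

theorem ceil_div_le (W : ModuleNetwork n m μ N T) (hm : 0 < m) (hq : 0 < n / m) {g : ℤ}
    (hg : g ≤ N) : ⌈(g : ℚ) / ((n / m : ℕ) : ℚ)⌉ ≤ (T : ℤ) := by
  rw [Int.ceil_le, div_le_iff₀ (by exact_mod_cast hq)]
  have h1 : (g : ℚ) ≤ N := by exact_mod_cast hg
  have h2 : (N : ℚ) ≤ (n / m : ℕ) * T := by exact_mod_cast W.le_div_mul hm
  rw [Int.cast_natCast]
  linarith

/-- Too few gates do not provide the parameters of all unitaries. -/
theorem negligible_support (W : ModuleNetwork n m μ N T) (h0 : 0 < μ) (h : μ < m)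
    (hq : 0 < n / m) (hk : n % m = k * μ) (hN : (N : ℤ) < gateExact n m μ k) :
    Negligible W.support := by
  classical
  choose A B F hAs hBs hFs hAB hA hB hF hz hnz using W.exists_overlaps
  intro ν hν
  refine haar_circuit_eq_zero W.support A B hAs hBs hAB hA hB ?_ ν
  have hμ : (0 : ℚ) < μ := by exact_mod_cast h0
  set Z := Finset.univ.filter fun i => (W.slot i : ℕ) = 0 with hZ
  have hZN : Z.card + (Finset.univ.filter fun i => ¬ (W.slot i : ℕ) = 0).card = N := by
    rw [hZ, Finset.card_filter_add_card_filter_not, Finset.card_univ, Fintype.card_fin]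
  -- The surplus `4^μ - 1` of an overhead is spread evenly over its `μ` qubits, so that fresh qubits
  -- can be summed instead of gates.
  have hcost (i : Fin N) :
      ((4 ^ (W.support i).card + 1 - 4 ^ (A i).card - 4 ^ (B i).card : ℕ) : ℚ) =
        (if (W.slot i : ℕ) = 0 then (4 ^ m - 1 : ℚ) else overlapParams m μ) +
          (F i).card * ((4 ^ μ - 1) / μ) := by
    have hle : 4 ^ (A i).card + 4 ^ (B i).card ≤ 4 ^ (W.support i).card + 1 := by
      refine four_pow_add_four_pow_le_succ ?_
      rw [← Finset.card_union_of_disjoint (hAB i)]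
      exact Finset.card_le_card (Finset.union_subset (hAs i) (hBs i))
    rw [Nat.sub_sub, Nat.cast_sub hle, W.card_support]
    push_cast
    split_ifs with hi
    · obtain ⟨h1, h2, h3⟩ := hz i hi
      rw [h1, h2, h3]
      simp
    · obtain ⟨h1, ⟨h2, h3⟩ | ⟨h2, h3⟩⟩ := hnz i hi
      · rw [h1, h2, h3, overlapParams]
        simp
        ring
      · rw [h1, h2, h3, overlapParams]
        field_simp
        simp
        ring
  have hsum : ((∑ i, (4 ^ (W.support i).card + 1 - 4 ^ (A i).card - 4 ^ (B i).card) : ℕ) : ℚ) =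
      Z.card * (4 ^ m - 1) + (N - Z.card) * overlapParams m μ +
        (∑ i, (F i).card : ℕ) * ((4 ^ μ - 1) / μ) := by
    have hZN' : ((Finset.univ.filter fun i => ¬ (W.slot i : ℕ) = 0).card : ℚ) = N - Z.card := by
      rw [eq_sub_iff_add_eq']
      exact_mod_cast hZN
    rw [Nat.cast_sum, Finset.sum_congr rfl fun i _ => hcost i, Finset.sum_add_distrib,
      Finset.sum_ite, Finset.sum_const, Finset.sum_const, nsmul_eq_mul, nsmul_eq_mul, hZN',
      ← Finset.sum_mul, Nat.cast_sum]
  -- Every qubit is counted at most once: first-slot gates are parallel, and an overhead avoids all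
  -- earlier supports.
  have hdisj : Z.card * m + ∑ i, (F i).card ≤ n := by
    calc Z.card * m + ∑ i, (F i).card
        = ∑ i, (if (W.slot i : ℕ) = 0 then W.support i else F i).card := by
          have (i : Fin N) : (if (W.slot i : ℕ) = 0 then W.support i else F i).card =
              (if (W.slot i : ℕ) = 0 then m else 0) + (F i).card := by
            split_ifs with hi
            · simp [W.card_support, hz i hi]
            · simp
          rw [Finset.sum_congr rfl fun i _ => this i, Finset.sum_add_distrib,
            ← Finset.sum_filter, Finset.sum_const, smul_eq_mul]
      _ ≤ n := sum_card_le_of_disjoint fun i j hij => by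
          by_cases hj : (W.slot j : ℕ) = 0
          · have hi : (W.slot i : ℕ) = 0 := by
              have : (W.slot i : ℕ) ≤ W.slot j := W.slot_mono hij.le
              omega
            rw [if_pos hi, if_pos hj]
            exact W.parallel i j hij.ne (Fin.ext (hi.trans hj.symm))
          · rw [if_neg hj]
            refine Disjoint.mono_left ?_ (hF j i hij).symm
            split_ifs
            · exact subset_rfl
            · exact hFs i
  have hN' := (gateExact_le_iff h0 h (N : ℤ)).not.1 hN.not_ge
  rw [not_le, Int.cast_natCast] at hN'
  have hc := overlapParams_pos h0 h
  have h4μ := four_le_four_pow h0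
  have h4m := four_le_four_pow (h0.trans h)
  have hk0 : (0 : ℚ) ≤ k * (4 ^ μ - 1) := mul_nonneg (Nat.cast_nonneg _) (by linarith)
  suffices hs : ((∑ i, (4 ^ (W.support i).card + 1 - 4 ^ (A i).card - 4 ^ (B i).card) : ℕ) : ℚ)
      + 1 < 4 ^ n by exact_mod_cast hs
  rw [hsum]
  by_cases hlate : ∃ i, (W.slot i : ℕ) ≠ 0
  · have hZq : Z.card = n / m := W.first_slot hlate
    have hF' : ((∑ i, (F i).card : ℕ) : ℚ) ≤ k * μ := by
      have := Nat.div_add_mod n m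
      rw [hZq, mul_comm] at hdisj
      exact_mod_cast (by omega : ∑ i, (F i).card ≤ k * μ)
    have h5 : ((∑ i, (F i).card : ℕ) : ℚ) * ((4 ^ μ - 1) / μ) ≤ k * (4 ^ μ - 1) := by
      calc _ ≤ (k * μ : ℚ) * ((4 ^ μ - 1) / μ) :=
            mul_le_mul_of_nonneg_right hF' (div_nonneg (by linarith) hμ.le)
        _ = k * (4 ^ μ - 1) := by field_simp
    rw [hZq]
    linarith
  -- All gates lie in the first slot, which need not be full; then there are at most `n / m` of them
  -- and no overheads.
  · push Not at hlate
    have hF0 : ∑ i, (F i).card = 0 := by simp [hz _ (hlate _)]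
    have hZn : Z.card = N := by simp [hZ, hlate]
    rw [hZn, hF0, add_zero] at hdisj
    have hNq : N ≤ n / m := (Nat.le_div_iff_mul_le (h0.trans h)).2 hdisj
    rw [hF0, hZn]
    rcases hNq.eq_or_lt with he | hlt
    · rw [← he] at hN'
      push_cast
      linarith
    · have h6 := add_mul_four_pow_le_cast h0 h hq hk
      have h7 : (N : ℚ) + 1 ≤ (n / m : ℕ) := by exact_mod_cast hlt
      have h8 : (0 : ℚ) ≤ N := Nat.cast_nonneg _
      have h9 : (0 : ℚ) ≤ k := Nat.cast_nonneg _
      push_cast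
      nlinarith

end ModuleNetwork

/-- For a generic unitary, `g` gates are necessary in all networks where the parameter count
demands `g` gates. -/
theorem generic_network (hmn : 0 < n / m) (g : ℤ) : Generic n fun u =>
    ∀ (ν k N T : ℕ) (W : ModuleNetwork n m ν N T), 0 < ν → ν < m → n % m = k * ν →
      g ≤ gateExact n m ν k → Implements W.support u →
        g ≤ (N : ℤ) ∧ ⌈(g : ℚ) / ((n / m : ℕ) : ℚ)⌉ ≤ (T : ℤ) := by
  refine (generic_not_implements n g.toNat).mono fun u hu ν k N T W h0 h hk hg hW => ?_
  have hle : g ≤ (N : ℤ) := by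
    by_contra hlt
    rw [not_le] at hlt
    exact hu N (by omega) W.support (W.negligible_support h0 h hmn hk (hlt.trans_le hg)) hW
  exact ⟨hle, W.ceil_div_le (h0.trans h) hmn hle⟩

/-- The last earlier gate touching a single qubit is automatically adjacent on it. -/
theorem overlaps_singleton {S : Fin N → Finset (Fin n)} {i j : Fin N} {a : Fin n} (hj : j < i)
    (ha : a ∈ S j) : Overlaps S i {a} := by
  have hne : (Finset.univ.filter fun j => j < i ∧ a ∈ S j).Nonempty := ⟨j, by simp [hj, ha]⟩
  obtain ⟨l, hl, hmax⟩ := Finset.exists_max_image _ id hne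
  simp only [Finset.mem_filter, Finset.mem_univ, true_and, id] at hl hmax
  refine ⟨l, hl.1, by simpa using hl.2, fun p hlp hpi => ?_⟩
  rw [Finset.disjoint_singleton_left]
  exact fun hp => absurd (hmax p ⟨hpi, hp⟩) (not_le.2 hlp)

/-- Two-qubit circuits with too few gates are negligible. -/
theorem negligible_of_card_two {S : Fin N → Finset (Fin n)} (hS : ∀ i, (S i).card = 2)
    (hN : 9 * N + 3 * n + 1 < 4 ^ n) : Negligible S := by
  classical
  let F : Fin N → Finset (Fin n) := fun i => (S i).filter fun a => ∀ j < i, a ∉ S j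
  have hdisj : ∑ i, (F i).card ≤ n := sum_card_le_of_disjoint fun i j hij => by
    rw [Finset.disjoint_left]
    intro a hai haj
    exact (Finset.mem_filter.1 haj).2 i hij (Finset.mem_filter.1 hai).1
  have hex (i : Fin N) : ∃ A B : Finset (Fin n), A ⊆ S i ∧ B ⊆ S i ∧ Disjoint A B ∧
      (A = ∅ ∨ Overlaps S i A) ∧ (B = ∅ ∨ Overlaps S i B) ∧
      -- `16 + 1 - 4 - 4 = 9`, and each fresh qubit turns a `4` into `4^0 = 1`.
      4 ^ (S i).card + 1 - 4 ^ A.card - 4 ^ B.card = 9 + 3 * (F i).card := by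
    obtain ⟨a, b, hab, hSi⟩ := Finset.card_eq_two.1 (hS i)
    have hsingle (c : Fin n) : ∃ C : Finset (Fin n), C ⊆ {c} ∧ (C = ∅ ∨ Overlaps S i C) ∧
        4 ^ C.card + 3 * (if ∀ j < i, c ∉ S j then 1 else 0) = 4 := by
      by_cases hc : ∀ j < i, c ∉ S j
      · exact ⟨∅, by simp, Or.inl rfl, by rw [if_pos hc]; simp⟩
      · refine ⟨{c}, subset_rfl, Or.inr ?_, by rw [if_neg hc]; simp⟩
        push Not at hc
        obtain ⟨j, hj, hcj⟩ := hc
        exact overlaps_singleton hj hcj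
    obtain ⟨A, hA, hA', hAc⟩ := hsingle a
    obtain ⟨B, hB, hB', hBc⟩ := hsingle b
    have hFi : (F i).card = (if ∀ j < i, a ∉ S j then 1 else 0) +
        (if ∀ j < i, b ∉ S j then 1 else 0) := by
      simp only [F, Finset.card_filter]
      rw [hSi, Finset.sum_pair hab]
    refine ⟨A, B, hA.trans (by simp [hSi]), hB.trans (by simp [hSi]),
      (Finset.disjoint_singleton.2 hab).mono hA hB, hA', hB', ?_⟩
    rw [hS i, hFi]
    omega
  choose A B hA hB hAB hA' hB' hcost using hex
  intro ν hν
  refine haar_circuit_eq_zero S A B hA hB hAB hA' hB' ?_ ν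
  rw [Finset.sum_congr rfl fun i _ => hcost i, Finset.sum_add_distrib, ← Finset.mul_sum,
    Finset.sum_const, Finset.card_univ, Fintype.card_fin, smul_eq_mul]
  omega

/-- Divisibility by 9 makes the ceilings exact for `m = 2`. -/
theorem exists_four_pow_eq (n : ℕ) : ∃ t : ℕ, 4 ^ n = 9 * t + 3 * n + 1 := by
  induction n with
  | zero => exact ⟨0, rfl⟩
  | succ n ih =>
    obtain ⟨t, ht⟩ := ih
    exact ⟨4 * t + n, by rw [pow_succ, ht]; ring⟩

theorem gateA_two (h : Even n) : (gateA n 2 1 : ℚ) = (4 ^ n - 3 * n - 1) / 9 := by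
  obtain ⟨t, ht⟩ := exists_four_pow_eq n
  obtain ⟨p, rfl⟩ := h
  have hp : (p + p) / 2 = p := by omega
  have ht' : (4 : ℚ) ^ (p + p) = 9 * t + 3 * (p + p : ℕ) + 1 := by exact_mod_cast ht
  have hx : ((4 : ℚ) ^ (p + p) - 1 - (((p + p) / 2 : ℕ) : ℚ) * (4 ^ 2 - 1)) /
      (4 ^ 2 - 4 ^ 1 - 4 ^ (2 - 1) + 1) + (((p + p) / 2 : ℕ) : ℚ) = ((t : ℤ) : ℚ) := by
    rw [ht', hp]
    push_cast
    ring
  rw [gateA, hx, Int.ceil_intCast, ht']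
  push_cast
  ring

theorem gateB_two (h : Odd n) : (gateB n 2 1 : ℚ) = (4 ^ n - 3 * n - 1) / 9 := by
  obtain ⟨t, ht⟩ := exists_four_pow_eq n
  obtain ⟨p, rfl⟩ := h
  have hp : (2 * p + 1) / 2 = p := by omega
  have ht' : (4 : ℚ) ^ (2 * p + 1) = 9 * t + 3 * (2 * p + 1 : ℕ) + 1 := by exact_mod_cast ht
  have hx : ((4 : ℚ) ^ (2 * p + 1) - 4 ^ (2 - 1) - (((2 * p + 1) / 2 : ℕ) : ℚ) * (4 ^ 2 - 1)) /
      (4 ^ 2 - 4 ^ 1 - 4 ^ (2 - 1) + 1) + (((2 * p + 1) / 2 : ℕ) : ℚ) = ((t : ℤ) : ℚ) := by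
    rw [ht', hp]
    push_cast
    ring
  rw [gateB, hx, Int.ceil_intCast, ht']
  push_cast
  ring

theorem generic_two_qubit (n : ℕ) : Generic n fun u => ∀ (N : ℕ) (S : Fin N → Finset (Fin n)),
    (∀ i, (S i).card = 2) → Implements S u → ((4 : ℚ) ^ n - 3 * n - 1) / 9 ≤ (N : ℚ) := by
  refine (generic_not_implements n (4 ^ n)).mono fun u hu N S hS hSu => ?_
  by_contra hlt
  rw [not_le, lt_div_iff₀ (by norm_num)] at hlt
  have hN : 9 * N + 3 * n + 1 < 4 ^ n := by
    have : (9 * N + 3 * n + 1 : ℚ) < 4 ^ n := by linarith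
    exact_mod_cast this
  exact hu N (by omega) S (negligible_of_card_two hS hN) hSu

end Networks

end

/-! ### Assembly of the claims. -/

theorem mainTheorem7 (n m μ : ℕ) (hμ : 0 < μ) (hμm : μ < m) (hmn : m ≤ n) :
    -- the parameter counts of the group and of the cosets
    (dimSU (2 ^ m) = 4 ^ m - 1 ∧
      dimCosetLeft (2 ^ (m - μ)) (2 ^ μ) = 4 ^ (m - μ) * (4 ^ μ - 1) ∧
      dimCosetBoth (2 ^ (m - μ)) (2 ^ μ) = (4 ^ (m - μ) - 1) * (4 ^ μ - 1)) ∧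
    -- with `k` overheads: the least number of gates that exhausts the parameters of `SU(2^n)`
    (∀ k : ℕ, n % m = k * μ →
      ∃ g : ℕ, (g : ℤ) = gateExact n m μ k ∧
        IsLeast {N : ℕ | n / m + k ≤ N ∧ dimSU (2 ^ n) ≤ paramCount n m μ k N} g) ∧
    -- ... is a lower bound for the gates needed by a generic unitary, likewise for time slots
    (∀ k : ℕ, n % m = k * μ →
      Generic n fun u => ∀ (N T : ℕ) (W : ModuleNetwork n m μ N T), Implements W.support u →
        gateExact n m μ k ≤ (N : ℤ) ∧ slotExact n m μ k ≤ (T : ℤ)) ∧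
    -- the bounds without overhead, with one overhead, and with two overheads
    (gateExact n m μ 0 = gateA n m μ ∧ slotExact n m μ 0 = slotA n m μ) ∧
    (n % m = 0 →
      Generic n fun u => ∀ (N T : ℕ) (W : ModuleNetwork n m μ N T), Implements W.support u →
        gateA n m μ ≤ (N : ℤ) ∧ slotA n m μ ≤ (T : ℤ)) ∧
    (n % m = μ → 2 * μ ≤ m →
      Generic n fun u => ∀ (N T : ℕ) (W : ModuleNetwork n m μ N T), Implements W.support u →
        gateB n m μ ≤ (N : ℤ) ∧ slotB n m μ ≤ (T : ℤ)) ∧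
    (n % m = 2 * μ →
      Generic n fun u => ∀ (N T : ℕ) (W : ModuleNetwork n m μ N T), Implements W.support u →
        gateC n m μ ≤ (N : ℤ) ∧ slotC n m μ ≤ (T : ℤ)) ∧
    -- for `m = 2 μ` the exact counts are the closed formulas
    (m = 2 * μ → gateExact n m μ 1 = gateB n m μ ∧ gateExact n m μ 2 = gateC n m μ) ∧
    -- the numbers of time slots match the numbers of gates
    (slotA n m μ = ⌈(gateA n m μ : ℚ) / ((n / m : ℕ) : ℚ)⌉ ∧
      slotB n m μ = ⌈(gateB n m μ : ℚ) / ((n / m : ℕ) : ℚ)⌉ ∧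
      slotC n m μ = ⌈(gateC n m μ : ℚ) / ((n / m : ℕ) : ℚ)⌉ ∧
      ∀ k : ℕ, slotExact n m μ k = ⌈(gateExact n m μ k : ℚ) / ((n / m : ℕ) : ℚ)⌉) ∧
    (gateC n m μ ≤ gateB n m μ ∧ gateB n m μ ≤ gateA n m μ) ∧
    -- `g''_m` at the most efficient overlap `⌊m/2⌋` is a lower bound for all patterns
    (Generic n fun u => ∀ (ν N T : ℕ) (W : ModuleNetwork n m ν N T), 0 < ν → ν < m →
      (n % m = 0 ∨ n % m = ν ∨ n % m = 2 * ν) → Implements W.support u →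
        gateC n m (m / 2) ≤ (N : ℤ) ∧ slotC n m (m / 2) ≤ (T : ℤ)) ∧
    -- two-qubit gates: the closed form, and the bound for arbitrary two-qubit circuits
    (m = 2 →
      (Even n → (gateA n 2 1 : ℚ) = (4 ^ n - 3 * n - 1) / 9) ∧
      (Odd n → (gateB n 2 1 : ℚ) = (4 ^ n - 3 * n - 1) / 9) ∧
      Generic n fun u => ∀ (N : ℕ) (S : Fin N → Finset (Fin n)), (∀ i, (S i).card = 2) →
        Implements S u → ((4 : ℚ) ^ n - 3 * n - 1) / 9 ≤ (N : ℚ)) := by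
  have hq : 0 < n / m := Nat.div_pos hmn (hμ.trans hμm)
  have hC {ν k : ℕ} (hν : 0 < ν) (hνm : ν < m) (hk : n % m = k * ν) (hk2 : k ≤ 2) :=
    gateC_half_le_gateExact hν hνm hq hk hk2
  refine ⟨⟨dimSU_two_pow m, dimCosetLeft_two_pow m μ, dimCosetBoth_two_pow m μ⟩,
    fun k hk => exists_isLeast_gateExact hμ hμm hq hk, fun k hk => ?_,
    ⟨gateExact_zero, slotExact_zero⟩, fun hk => ?_, fun hk h2 => ?_, fun hk => ?_,
    fun h => ⟨gateExact_one_of_eq h, gateExact_two_of_eq h⟩,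
    ⟨slotA_eq hq, slotB_eq hq, slotC_eq hq, slotExact_eq hq⟩,
    ⟨gateC_le_gateB hμ hμm, gateB_le_gateA hμ hμm⟩, ?_, fun _ =>
      ⟨gateA_two, gateB_two, generic_two_qubit n⟩⟩
  · rw [slotExact_eq hq]
    exact (generic_network hq _).mono fun u hu N T W => hu μ k N T W hμ hμm hk le_rfl
  · rw [slotA_eq hq]
    exact (generic_network hq _).mono fun u hu N T W =>
      hu μ 0 N T W hμ hμm (by simpa using hk) gateExact_zero.ge
  · rw [slotB_eq hq]
    exact (generic_network hq _).mono fun u hu N T W =>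
      hu μ 1 N T W hμ hμm (by simpa using hk) (gateB_le_gateExact hμ h2)
  · rw [slotC_eq hq]
    -- Here `2 * μ` is a remainder modulo `m`, so the condition needed for one overhead is
    -- automatic.
    have h2 : 2 * μ ≤ m := hk ▸ (Nat.mod_lt n (hμ.trans hμm)).le
    exact (generic_network hq _).mono fun u hu N T W =>
      hu μ 2 N T W hμ hμm hk (gateC_le_gateExact hμ h2)
  · rw [slotC_eq hq]
    -- The threshold does not depend on `ν`, so a single generic set covers all overlaps.
    refine (generic_network hq (gateC n m (m / 2))).mono fun u hu ν N T W hν hνm hcase => ?_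
    obtain ⟨k, hk, hk2⟩ : ∃ k, n % m = k * ν ∧ k ≤ 2 := by
      rcases hcase with h | h | h
      · exact ⟨0, by simpa using h, by norm_num⟩
      · exact ⟨1, by simpa using h, by norm_num⟩
      · exact ⟨2, h, le_rfl⟩
    exact hu ν k N T W hν hνm hk (hC hν hνm hk hk2)
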